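/- Let $p\ge 0$, let $M,H\in\mathbb R^{p\times p}$ be positive semidefinite, $\phi,\psi\in\mathbb R^p$, $\kappa\in[0,\infty)^p$, and let $d>\lambda_p(M)$, $e>\lambda_p(H)$, where $\lambda_p$ is the spectral norm. For $\beta\in\mathbb R^p$ put $\theta=\theta(\beta)=\mathrm{sign}(\beta)\circ(|\beta|-\kappa)_+$ (componentwise), and assume that the posterior kernel $$\exp\big[-\tfrac12(\theta'M\theta-2\phi'\theta)\big]\exp\big[-\tfrac12(\beta'H\beta-2\psi'\beta)\big]$$ is integrable over $\beta\in\mathbb R^p$, so that it normalizes to a posterior distribution $\Pi(d\beta)$. (This covers the linear regression model $y=X\theta+\epsilon$, $\epsilon\sim \mathrm N(0,\Omega^{-1})$, $\beta_j\sim \mathrm N(0,\tau_j)$ independent, with $M=X'\Omega X$, $\phi=X'\Omega y$, $H=\mathrm{diag}(1/\tau_j)$, $\psi=0$.) Consider the two-block Gibbs sampler with $(M,\phi,H,\psi,\kappa)$ fixed. (i) Given $\beta$, draw independently $r\sim \mathrm N[(dI-M)\theta,\,dI-M]$ and $t\sim \mathrm N[(eI-H)\beta,\,eI-H]$. (ii)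 Given $(r,t)$, draw the coordinates of $\beta$ independently. Coordinate $\beta_j$ has the mixture law in which $b_j\in\{1,0,-1\}$ has probability proportional to $$\begin{aligned} b_j=1:&\quad m_1^{-1}\exp\Big[\tfrac{(\phi_j+r_j+\psi_j+t_j+d\kappa_j)^2}{2(d+e)}-\tfrac12 d\kappa_j^2-(\phi_j+r_j)\kappa_j\Big],\\ b_j=0:&\quad m_0^{-1}\exp\Big[\tfrac{(\psi_j+t_j)^2}{2e}\Big],\\ b_j=-1:&\quad m_{-1}^{-1}\exp\Big[\tfrac{(\phi_j+r_j+\psi_j+t_j-d\kappa_j)^2}{2(d+e)}-\tfrac12 d\kappa_j^2+(\phi_j+r_j)\kappa_j\Big],\end{aligned}$$ and, given $b_j$, $\beta_j$ is respectively $\mathrm N_{(\kappa_j,\infty)}\big(\tfrac{\phi_j+r_j+\psi_j+t_j+d\kappa_j}{d+e},\tfrac1{d+e}\big)$, $\mathrm N_{(-\kappa_j,\kappa_j)}\big(\tfrac{\psi_j+t_j}{e},\tfrac1e\big)$, $\mathrm N_{(-\infty,-\kappa_j)}\big(\tfrac{\phi_j+r_j+\psi_j+t_j-d\kappa_j}{d+e},\tfrac1{d+e}\big)$.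 Here $\mathrm N_S(\mu,v)$ is the Gaussian truncated to $S$, and $m_{b}^{-1}=\int_S e^{-(x-\mu)^2/(2v)}dx$ for the component $b$. If $\kappa_j=0$ the component $b_j=0$ has probability $0$ and is absent. Let $P^m_{r,t}[(r^0,t^0),\cdot]$ be the law of $(r^m,t^m)$ after $m$ sweeps started at $(r^0,t^0)$, where a sweep draws $\beta$ by (ii) from the current $(r,t)$ and then a new $(r,t)$ by (i) from that $\beta$. Let $\mu_{r,t}$ be the law of $(r,t)$ when $\beta\sim\Pi$ and $(r,t)$ is drawn given $\beta$ by (i). Then the marginal chain of $(r,t)$ is geometrically ergodic: there are a real-valued function $C_1(r^0,t^0)$ and a constant $0<\gamma<1$ such that, for all $(r^0,t^0)\in\mathbb R^p\times\mathbb R^p$ and all $m\ge 0$, $$\big\|P^m_{r,t}[(r^0,t^0),\cdot]-\mu_{r,t}(\cdot)\big\|_{\mathrm{TV}}\le C_1(r^0,t^0)\,\gamma^m ,$$ where $\|\mu-\nu\|_{\mathrm{TV}}=\sup_A|\mu(A)-\nu(A)|$ over measurable sets $A$. -/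

import Mathlib

open MeasureTheory ProbabilityTheory

noncomputable section

namespace AntiCorrelation

/-- The vectors `β`, `θ`, `r`, `t`, `φ`, `ψ`, `κ` all live in `ℝ^p`. -/
abbrev Vec (p : ℕ) := EuclideanSpace ℝ (Fin p)

/-- The fixed quantities of the model and of the sampler (data only, no assumptions). -/
structure Params (p : ℕ) where
  M : Matrix (Fin p) (Fin p) ℝ
  H : Matrix (Fin p) (Fin p) ℝ
  φ : Vec p
  ψ : Vec p
  κ : Vec p
  d : ℝ
  e : ℝ

/-- Soft thresholding of a real number: `sign(x) (|x| - k)_+`. -/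
def softThreshold (k x : ℝ) : ℝ := Real.sign x * max (|x| - k) 0

/-- Spectral norm (the `ℓ²` operator norm) of a real square matrix. -/
def spectralNorm {p : ℕ} (A : Matrix (Fin p) (Fin p) ℝ) : ℝ :=
  ‖Matrix.toEuclideanCLM (𝕜 := ℝ) A‖

variable {p : ℕ}

namespace Params

/-- `θ = sign(β) ∘ (|β| - κ)_+`, componentwise. -/
def theta (Q : Params p) (β : Vec p) : Vec p :=
  WithLp.toLp 2 fun j => softThreshold (Q.κ j) (β j)

/-! ### The posterior of `β` -/

/-- Unnormalized posterior density of `β`: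
`exp[-(θ'Mθ - 2φ'θ)/2] exp[-(β'Hβ - 2ψ'β)/2]` with `θ` the soft-thresholded `β`. -/
def posteriorKernel (Q : Params p) (β : Vec p) : ℝ :=
  Real.exp (-(1 / 2) * (inner ℝ (Q.theta β) (Matrix.toEuclideanCLM (𝕜 := ℝ) Q.M (Q.theta β))
      - 2 * inner ℝ Q.φ (Q.theta β))) *
    Real.exp (-(1 / 2) * (inner ℝ β (Matrix.toEuclideanCLM (𝕜 := ℝ) Q.H β)
      - 2 * inner ℝ Q.ψ β))

/-- The posterior distribution of `β` (normalized to total mass one). -/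
def posterior (Q : Params p) : Measure (Vec p) :=
  (∫⁻ β, ENNReal.ofReal (Q.posteriorKernel β))⁻¹ •
    (volume : Measure (Vec p)).withDensity fun β => ENNReal.ofReal (Q.posteriorKernel β)

end Params

/-! ### Truncated Gaussians -/

/-- `∫_S exp(-(x - m)²/(2v)) dx`, the reciprocal of the constant of the truncated Gaussian. -/
def truncMass (S : Set ℝ) (m v : ℝ) : ℝ :=
  ∫ x in S, Real.exp (-(x - m) ^ 2 / (2 * v))

/-- Density of the Gaussian `N(m, v)` truncated to `S`. -/
def truncDensity (S : Set ℝ) (m v x : ℝ) : ℝ :=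
  S.indicator (fun x => (truncMass S m v)⁻¹ * Real.exp (-(x - m) ^ 2 / (2 * v))) x

/-! ### The draw of `β` given `(r, t)` -/

namespace Params

/-- Support of the component `b ∈ {1, 0, -1}` for coordinate `j`. -/
def compSupport (Q : Params p) (j : Fin p) : SignType → Set ℝ
  | .pos => Set.Ioi (Q.κ j)
  | .zero => Set.Ioo (-Q.κ j) (Q.κ j)
  | .neg => Set.Iio (-Q.κ j)

/-- Location parameter of the truncated Gaussian component `b` for coordinate `j`. -/
def compMean (Q : Params p) (r t : Vec p) (j : Fin p) : SignType → ℝ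
  | .pos => (Q.φ j + r j + Q.ψ j + t j + Q.d * Q.κ j) / (Q.d + Q.e)
  | .zero => (Q.ψ j + t j) / Q.e
  | .neg => (Q.φ j + r j + Q.ψ j + t j - Q.d * Q.κ j) / (Q.d + Q.e)

/-- Scale parameter (variance before truncation) of the component `b`. -/
def compVar (Q : Params p) : SignType → ℝ
  | .pos => 1 / (Q.d + Q.e)
  | .zero => 1 / Q.e
  | .neg => 1 / (Q.d + Q.e)

/-- Exponent in the mixture weight of the component `b` for coordinate `j`. -/
def compExponent (Q : Params p) (r t : Vec p) (j : Fin p) : SignType → ℝ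
  | .pos => (Q.φ j + r j + Q.ψ j + t j + Q.d * Q.κ j) ^ 2 / (2 * (Q.d + Q.e))
      - Q.d * Q.κ j ^ 2 / 2 - (Q.φ j + r j) * Q.κ j
  | .zero => (Q.ψ j + t j) ^ 2 / (2 * Q.e)
  | .neg => (Q.φ j + r j + Q.ψ j + t j - Q.d * Q.κ j) ^ 2 / (2 * (Q.d + Q.e))
      - Q.d * Q.κ j ^ 2 / 2 + (Q.φ j + r j) * Q.κ j

/-- Unnormalized mixture weight of the component `b` for coordinate `j`. -/
def compWeight (Q : Params p) (r t : Vec p) (j : Fin p) (b : SignType) : ℝ :=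
  truncMass (Q.compSupport j b) (Q.compMean r t j b) (Q.compVar b) *
    Real.exp (Q.compExponent r t j b)

/-- Probability that `b_j = b` given `(r, t)`. -/
def compProb (Q : Params p) (r t : Vec p) (j : Fin p) (b : SignType) : ℝ :=
  Q.compWeight r t j b / ∑ b' : SignType, Q.compWeight r t j b'

/-- Density at `x` of `β_j` given `(r, t)`: a mixture of three truncated Gaussians. -/
def coordDensity (Q : Params p) (r t : Vec p) (j : Fin p) (x : ℝ) : ℝ :=
  ∑ b : SignType, Q.compProb r t j b *
    truncDensity (Q.compSupport j b) (Q.compMean r t j b) (Q.compVar b) x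

/-- Density of the vector `β` given `(r, t)`: the coordinates are independent. -/
def blockDensity (Q : Params p) (r t β : Vec p) : ℝ :=
  ∏ j, Q.coordDensity r t j (β j)

end Params

theorem measurable_truncMass (S : Set ℝ) (v : ℝ) : Measurable fun m => truncMass S m v := by
  have h : StronglyMeasurable
      (Function.uncurry fun (m x : ℝ) => Real.exp (-(x - m) ^ 2 / (2 * v))) := by
    apply Measurable.stronglyMeasurable
    simp only [Function.uncurry_def]
    fun_prop
  exact (h.integral_prod_right (ν := volume.restrict S)).measurable

namespace Params

theorem measurableSet_compSupport (Q : Params p) (j : Fin p) (b : SignType) :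
    MeasurableSet (Q.compSupport j b) := by
  cases b
  · exact measurableSet_Ioo
  · exact measurableSet_Iio
  · exact measurableSet_Ioi

theorem measurable_compMean (Q : Params p) (j : Fin p) (b : SignType) :
    Measurable fun x : Vec p × Vec p => Q.compMean x.1 x.2 j b := by
  cases b <;> simp only [compMean] <;> fun_prop

theorem measurable_compExponent (Q : Params p) (j : Fin p) (b : SignType) :
    Measurable fun x : Vec p × Vec p => Q.compExponent x.1 x.2 j b := by
  cases b <;> simp only [compExponent] <;> fun_prop

theorem measurable_compWeight (Q : Params p) (j : Fin p) (b : SignType) :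
    Measurable fun x : Vec p × Vec p => Q.compWeight x.1 x.2 j b :=
  ((measurable_truncMass _ _).comp (Q.measurable_compMean j b)).mul
    (Real.measurable_exp.comp (Q.measurable_compExponent j b))

theorem measurable_compProb (Q : Params p) (j : Fin p) (b : SignType) :
    Measurable fun x : Vec p × Vec p => Q.compProb x.1 x.2 j b :=
  (Q.measurable_compWeight j b).div
    (Finset.measurable_sum _ fun b' _ => Q.measurable_compWeight j b')

theorem measurable_truncDensity (Q : Params p) (j : Fin p) (b : SignType) :
    Measurable fun z : (Vec p × Vec p) × ℝ =>
      truncDensity (Q.compSupport j b) (Q.compMean z.1.1 z.1.2 j b) (Q.compVar b) z.2 := by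
  have h1 : Measurable fun z : (Vec p × Vec p) × ℝ => Q.compMean z.1.1 z.1.2 j b :=
    (Q.measurable_compMean j b).comp measurable_fst
  have h2 : Measurable fun z : (Vec p × Vec p) × ℝ =>
      (truncMass (Q.compSupport j b) (Q.compMean z.1.1 z.1.2 j b) (Q.compVar b))⁻¹ *
        Real.exp (-(z.2 - Q.compMean z.1.1 z.1.2 j b) ^ 2 / (2 * Q.compVar b)) := by
    refine ((measurable_truncMass _ _).comp h1).inv.mul (Real.measurable_exp.comp ?_)
    exact (((measurable_snd.sub h1).pow_const 2).neg).div_const _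
  exact h2.indicator (measurable_snd (Q.measurableSet_compSupport j b))

theorem measurable_coordDensity (Q : Params p) (j : Fin p) :
    Measurable fun z : (Vec p × Vec p) × ℝ => Q.coordDensity z.1.1 z.1.2 j z.2 := by
  unfold coordDensity
  refine Finset.measurable_sum Finset.univ fun b _ => ?_
  exact ((Q.measurable_compProb j b).comp measurable_fst).mul (Q.measurable_truncDensity j b)

theorem measurable_blockDensity (Q : Params p) :
    Measurable fun z : (Vec p × Vec p) × Vec p => Q.blockDensity z.1.1 z.1.2 z.2 := by
  unfold blockDensity
  refine Finset.measurable_prod Finset.univ fun j _ => ?_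
  have hj : Measurable fun β : Vec p => β j := by fun_prop
  have h : Measurable fun z : (Vec p × Vec p) × Vec p => (z.1, z.2 j) :=
    measurable_fst.prodMk (hj.comp measurable_snd)
  have h2 := (Q.measurable_coordDensity j).comp h
  simp only [Function.comp_def] at h2
  exact h2

/-- The Markov kernel of the draw of `β` given `(r, t)`. -/
def betaKernel (Q : Params p) : Kernel (Vec p × Vec p) (Vec p) where
  toFun x := (volume : Measure (Vec p)).withDensity
    fun β => ENNReal.ofReal (Q.blockDensity x.1 x.2 β)
  measurable' := by
    refine Measure.measurable_of_measurable_coe _ fun s hs => ?_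
    simp only [withDensity_apply _ hs]
    exact (Q.measurable_blockDensity.ennreal_ofReal).lintegral_prod_right'

end Params

/-! ### The draw of `(r, t)` given `β` -/

open scoped MatrixOrder in
theorem measurable_multivariateGaussian (S : Matrix (Fin p) (Fin p) ℝ) :
    Measurable fun m : Vec p => multivariateGaussian m S := by
  refine Measure.measurable_of_measurable_coe _ fun s hs => ?_
  have h : ∀ m : Vec p, multivariateGaussian m S s =
      stdGaussian (Vec p) (Prod.mk m ⁻¹' {z : Vec p × Vec p |
        z.1 + Matrix.toEuclideanCLM (𝕜 := ℝ) (CFC.sqrt S) z.2 ∈ s}) := by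
    intro m
    rw [multivariateGaussian, Measure.map_apply (by fun_prop) hs]
    rfl
  simp only [h]
  exact measurable_measure_prodMk_left
    ((by fun_prop : Measurable fun z : Vec p × Vec p =>
      z.1 + Matrix.toEuclideanCLM (𝕜 := ℝ) (CFC.sqrt S) z.2) hs)

theorem measurable_softThreshold (k : ℝ) : Measurable (softThreshold k) := by
  have h : Measurable Real.sign :=
    Measurable.ite measurableSet_Iio measurable_const
      (Measurable.ite measurableSet_Ioi measurable_const measurable_const)
  exact h.mul (by fun_prop)

namespace Params

theorem measurable_theta (Q : Params p) : Measurable Q.theta := by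
  refine (PiLp.continuous_toLp 2 _).measurable.comp (measurable_pi_lambda _ fun j => ?_)
  exact (measurable_softThreshold _).comp (by fun_prop)

/-- The draw of `r` given `β`: the anti-correlation Gaussian `N((dI - M)θ, dI - M)`. -/
def rKernel (Q : Params p) : Kernel (Vec p) (Vec p) where
  toFun β := multivariateGaussian
    (Matrix.toEuclideanCLM (𝕜 := ℝ) (Q.d • (1 : Matrix (Fin p) (Fin p) ℝ) - Q.M) (Q.theta β))
    (Q.d • (1 : Matrix (Fin p) (Fin p) ℝ) - Q.M)
  measurable' := (measurable_multivariateGaussian _).comp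
    ((ContinuousLinearMap.measurable _).comp Q.measurable_theta)

/-- The draw of `t` given `β`: the anti-correlation Gaussian `N((eI - H)β, eI - H)`. -/
def tKernel (Q : Params p) : Kernel (Vec p) (Vec p) where
  toFun β := multivariateGaussian
    (Matrix.toEuclideanCLM (𝕜 := ℝ) (Q.e • (1 : Matrix (Fin p) (Fin p) ℝ) - Q.H) β)
    (Q.e • (1 : Matrix (Fin p) (Fin p) ℝ) - Q.H)
  measurable' := (measurable_multivariateGaussian _).comp (ContinuousLinearMap.measurable _)

instance (Q : Params p) : IsMarkovKernel Q.rKernel :=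
  ⟨fun _ => by dsimp [rKernel]; infer_instance⟩

instance (Q : Params p) : IsMarkovKernel Q.tKernel :=
  ⟨fun _ => by dsimp [tKernel]; infer_instance⟩

/-- The draw of `(r, t)` given `β`: `r` and `t` are conditionally independent. -/
def rtKernel (Q : Params p) : Kernel (Vec p) (Vec p × Vec p) :=
  Q.rKernel ×ₖ Q.tKernel

/-! ### The marginal chain of `(r, t)` and its target -/

/-- One sweep of the sampler, seen on `(r, t)`: draw `β` given the current `(r, t)`, then the
new `(r, t)` given that `β`; the value of `β` is integrated out. -/
def step (Q : Params p) : Kernel (Vec p × Vec p) (Vec p × Vec p) :=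
  Q.rtKernel ∘ₖ Q.betaKernel

/-- The law `P^m_{r,t}[(r⁰,t⁰), ·]` of `(r^m, t^m)` after `m` sweeps. -/
def stepIter (Q : Params p) : ℕ → Kernel (Vec p × Vec p) (Vec p × Vec p)
  | 0 => Kernel.id
  | m + 1 => Q.step ∘ₖ Q.stepIter m

/-- The target `μ_{r,t}`: the joint law of `(β, r, t)` with `β` drawn from the posterior and
`(r, t)` drawn given `β`, integrated over `β`. -/
def target (Q : Params p) : Measure (Vec p × Vec p) :=
  Q.rtKernel ∘ₘ Q.posterior

end Params

/-- Total variation distance `sup_A |μ(A) - ν(A)|` of two probability measures. -/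
def tvDist {α : Type*} [MeasurableSpace α] (μ ν : Measure α) : ℝ :=
  ⨆ A : {A : Set α // MeasurableSet A}, |μ.real A.1 - ν.real A.1|

end AntiCorrelation

end

/-! The mean and covariance of `(r, t)` given `β` are matched so that the quadratic forms of `M` and
`H` cancel. Relative to Lebesgue measure in `β` times a fixed centred Gaussian law of `(r, t)`, the
joint density is proportional to `exp (logJoint)`, where `β` enters only through `-d‖θ‖²/2 -
e‖β‖²/2` and linear terms (`posteriorKernel_mul_tilt`). This splits over coordinates, the mixture
law of `β` is its exact conditional (`betaKernel_eq`), and the target is invariant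
(`step_comp_target`).

Convergence comes from Harris' theorem (`exists_tvDist_le_geometric`), which needs a drift and a
minorization. Write `c = d + e`. Since `‖θ - β‖ ≤ ‖κ‖`, the law of `β` given `(r, t)` is comparable
to a Gaussian centred at `(r + t)/c`, up to factors exponential in `‖r‖ + ‖t‖`
(`exists_condDensity_bounds`). Those factors still leave a mean square deviation from the centre of
order `1 + ‖r‖ + ‖t‖` only, so the typical deviation is of square root order.

The new `r + t` has mean `(cI - M - H)β` plus a bounded term. Integrability of the posterior kernel
forces `M + H` to be positive definite (`inner_add_pos_of_integrable`), so `cI - M - H` has norm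
less than `c` (`exists_norm_smul_sub_le`), and `‖r + t‖` contracts up to a square root error in `‖r‖
+ ‖t‖`. As `r` and `t` may be large while their sum is small, the Lyapunov function is `‖r + t‖ +
ε(‖r‖ + ‖t‖)`: for small `ε` the contraction survives, and the added term absorbs the error
(`exists_drift`). Its sublevel sets are bounded, and there the density of `β` is bounded below on a
ball (`exists_minorization`). -/

noncomputable section

namespace AntiCorrelation

/-! ### Harris' theorem: drift and minorization imply geometric ergodicity -/

section Harris

variable {X : Type*} [MeasurableSpace X]

/-- Comparison of the integrals of a function with weighted oscillation bound against two finite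
measures of the same mass `s`. -/
theorem mul_integral_sub_le_of_sub_le {μ ν : Measure X} [IsFiniteMeasure μ] [IsFiniteMeasure ν]
    {f V : X → ℝ} {a b s : ℝ} (hμ : μ.real Set.univ = s) (hν : ν.real Set.univ = s)
    (hfμ : Integrable f μ) (hfν : Integrable f ν) (hVμ : Integrable V μ) (hVν : Integrable V ν)
    (h : ∀ u w, f u - f w ≤ a + b * V u + b * V w) :
    s * (∫ u, f u ∂μ - ∫ w, f w ∂ν) ≤ s * (a * s + b * (∫ u, V u ∂μ + ∫ w, V w ∂ν)) := by
  have h1 : ∀ u, s * f u - ∫ w, f w ∂ν ≤ s * (a + b * V u) + b * ∫ w, V w ∂ν := by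
    intro u
    have h2 : ∫ w, (f u - f w) ∂ν ≤ ∫ w, (a + b * V u + b * V w) ∂ν :=
      integral_mono ((integrable_const _).sub hfν) ((integrable_const _).add (hVν.const_mul b))
        (h u)
    rw [integral_sub (integrable_const _) hfν,
      integral_add (integrable_const _) (hVν.const_mul b), integral_const_mul] at h2
    simpa [hν] using h2
  have hi : Integrable (fun u => s * (a + b * V u)) μ :=
    ((integrable_const _).add (hVμ.const_mul b)).const_mul s
  have h3 : ∫ u, (s * f u - ∫ w, f w ∂ν) ∂μ ≤
      ∫ u, (s * (a + b * V u) + b * ∫ w, V w ∂ν) ∂μ :=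
    integral_mono ((hfμ.const_mul s).sub (integrable_const _))
      (hi.add (integrable_const _)) h1
  rw [integral_sub (hfμ.const_mul s) (integrable_const _),
    integral_add hi (integrable_const _), integral_const_mul, integral_const_mul,
    integral_add (integrable_const _) (hVμ.const_mul b), integral_const_mul] at h3
  simp only [integral_const, hμ, smul_eq_mul] at h3
  linarith

/-- The one-sided bound is used in both orders and its factor `s` cancelled; for `s = 0` both
measures vanish. -/
theorem abs_integral_sub_le_of_abs_sub_le {μ ν : Measure X} [IsFiniteMeasure μ]
    [IsFiniteMeasure ν] {f V : X → ℝ} {a b s : ℝ} (hμ : μ.real Set.univ = s)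
    (hν : ν.real Set.univ = s) (hfμ : Integrable f μ) (hfν : Integrable f ν)
    (hVμ : Integrable V μ) (hVν : Integrable V ν)
    (h : ∀ u w, |f u - f w| ≤ a + b * V u + b * V w) :
    |∫ u, f u ∂μ - ∫ w, f w ∂ν| ≤ a * s + b * (∫ u, V u ∂μ + ∫ w, V w ∂ν) := by
  rcases (hμ ▸ measureReal_nonneg : 0 ≤ s).eq_or_lt with hs | hs
  · have h1 : μ = 0 := by
      rw [← Measure.measure_univ_eq_zero]
      exact (measureReal_eq_zero_iff).1 (hμ.trans hs.symm)
    have h2 : ν = 0 := by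
      rw [← Measure.measure_univ_eq_zero]
      exact (measureReal_eq_zero_iff).1 (hν.trans hs.symm)
    simp [h1, h2, ← hs]
  · refine abs_le.2 ⟨?_, ?_⟩
    · have := le_of_mul_le_mul_left (mul_integral_sub_le_of_sub_le hν hμ hfν hfμ hVν hVμ
        (fun u w => (le_abs_self _).trans (h u w))) hs
      linarith
    · exact le_of_mul_le_mul_left (mul_integral_sub_le_of_sub_le hμ hν hfμ hfν hVμ hVν
        (fun u w => (le_abs_self _).trans (h u w))) hs

/-- Two probability measures sharing a common component `ρ`. -/
theorem abs_integral_sub_le_of_common_part {μ ν ρ : Measure X} [IsProbabilityMeasure μ]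
    [IsProbabilityMeasure ν] {f V : X → ℝ} {a b : ℝ} (hb : 0 ≤ b)
    (hρμ : ρ ≤ μ) (hρν : ρ ≤ ν) (hfμ : Integrable f μ) (hfν : Integrable f ν)
    (hV : ∀ x, 0 ≤ V x) (hVμ : Integrable V μ) (hVν : Integrable V ν)
    (h : ∀ u w, |f u - f w| ≤ a + b * V u + b * V w) :
    |∫ u, f u ∂μ - ∫ w, f w ∂ν| ≤
      a * (1 - ρ.real Set.univ) + b * (∫ u, V u ∂μ + ∫ w, V w ∂ν) := by
  have : IsFiniteMeasure ρ := isFiniteMeasure_of_le μ hρμ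
  have key : ∀ (τ : Measure X) [IsProbabilityMeasure τ], ρ ≤ τ → Integrable f τ →
      Integrable V τ → (τ - ρ).real Set.univ = 1 - ρ.real Set.univ ∧ Integrable f (τ - ρ) ∧
      Integrable V (τ - ρ) ∧ ∫ u, f u ∂τ = ∫ u, f u ∂(τ - ρ) + ∫ u, f u ∂ρ ∧
      ∫ u, V u ∂(τ - ρ) ≤ ∫ u, V u ∂τ := by
    intro τ _ hle hf hVi
    have hadd : τ - ρ + ρ = τ := Measure.sub_add_cancel_of_le hle
    have hf1 : Integrable f (τ - ρ) := hf.mono_measure Measure.sub_le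
    have hf2 : Integrable f ρ := hf.mono_measure hle
    have hV1 : Integrable V (τ - ρ) := hVi.mono_measure Measure.sub_le
    have hV2 : Integrable V ρ := hVi.mono_measure hle
    refine ⟨?_, hf1, hV1, ?_, ?_⟩
    · have : (τ - ρ + ρ).real Set.univ = 1 := by rw [hadd]; simp
      rw [measureReal_add_apply] at this
      linarith
    · rw [← integral_add_measure hf1 hf2, hadd]
    · conv_rhs => rw [← hadd, integral_add_measure hV1 hV2]
      have := integral_nonneg (μ := ρ) (f := V) hV
      linarith
  obtain ⟨m1, f1, V1, e1, l1⟩ := key μ hρμ hfμ hVμ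
  obtain ⟨m2, f2, V2, e2, l2⟩ := key ν hρν hfν hVν
  have := abs_integral_sub_le_of_abs_sub_le m1 m2 f1 f2 V1 V2 h
  rw [e1, e2]
  calc _ = |∫ u, f u ∂(μ - ρ) - ∫ w, f w ∂(ν - ρ)| := by ring_nf
    _ ≤ _ := this
    _ ≤ _ := by gcongr

variable {P : Kernel X X} [IsMarkovKernel P] {V : X → ℝ} {g K : ℝ}

/-- One-step contraction of a weighted oscillation seminorm. -/
theorem exists_oscillation_contraction (hV : ∀ x, 0 ≤ V x) (hg1 : g < 1) (hK : 0 ≤ K)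
    (hint : ∀ x, Integrable V (P x)) (hdrift : ∀ x, ∫ u, V u ∂P x ≤ g * V x + K)
    (hminor : ∀ R : ℝ, ∃ ρ : Measure X, ρ ≠ 0 ∧ ∀ x, V x ≤ R → ρ ≤ P x) :
    ∃ b γ : ℝ, 0 < b ∧ 0 < γ ∧ γ < 1 ∧ ∀ (f : X → ℝ) (c : ℝ), 0 ≤ c →
      (∀ x, Integrable f (P x)) → (∀ x y, |f x - f y| ≤ c * (2 + b * (V x + V y))) →
      ∀ x y, |∫ u, f u ∂P x - ∫ u, f u ∂P y| ≤ c * γ * (2 + b * (V x + V y)) := by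
  rcases isEmpty_or_nonempty X with hX | hX
  · exact ⟨1, 1 / 2, by norm_num, by norm_num, by norm_num, fun f c _ _ _ x => (hX.false x).elim⟩
  -- Above the level `R` the drift alone contracts; below it the common component does. The
  -- constants `b` and `δ` below are tuned to make both cases work.
  set R : ℝ := 8 * K / (1 - g) + 1 with hR
  -- The maximum makes the sublevel set nonempty, so that `ρ` lies below a probability measure and
  -- has mass at most one.
  obtain ⟨ρ, hρ0, hρ⟩ := hminor (max R (V hX.some))
  have hle := hρ hX.some (le_max_right _ _)
  have : IsFiniteMeasure ρ := isFiniteMeasure_of_le _ hle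
  set α : ℝ := ρ.real Set.univ with hα
  have hα0 : 0 < α := by
    rw [hα, measureReal_def]
    exact ENNReal.toReal_pos (by simpa using hρ0) (measure_ne_top _ _)
  have hα1 : α ≤ 1 := by
    have := ENNReal.toReal_mono (measure_ne_top _ _) (hle Set.univ)
    simpa [hα, measureReal_def] using this
  set b : ℝ := α / (2 * (K + 1)) with hbdef
  have hb : 0 < b := by positivity
  have hbK : 2 * b * K ≤ α := by
    rw [hbdef]
    have : α / (2 * (K + 1)) * (2 * (K + 1)) = α := by field_simp
    nlinarith
  have h1g : 0 < 1 - g := by linarith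
  -- For `S ≤ R` the gain `2α` less `2bK ≤ α` leaves `α ≥ 2δ`. For `S ≥ R` the gain `b(1 - g)S` pays
  -- a quarter each for `2bK` and `2δ`, and a half for `δbS`.
  obtain ⟨δ, hδ0, hδ1, hδ2, hδ3⟩ : ∃ δ : ℝ, 0 < δ ∧ δ ≤ α / 2 ∧ δ ≤ (1 - g) / 2 ∧
      δ ≤ b * (1 - g) / 8 := by
    refine ⟨min (α / 2) (min ((1 - g) / 2) (b * (1 - g) / 8)), ?_, min_le_left _ _,
      (min_le_right _ _).trans (min_le_left _ _), (min_le_right _ _).trans (min_le_right _ _)⟩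
    refine lt_min (by positivity) (lt_min (by positivity) (by positivity))
  refine ⟨b, 1 - δ, hb, by linarith, by linarith, fun f c hc hf hosc x y => ?_⟩
  have hosc' : ∀ u w, |f u - f w| ≤ 2 * c + (c * b) * V u + (c * b) * V w := fun u w => by
    have := hosc u w
    linarith
  set S := V x + V y with hS
  have hS0 : 0 ≤ S := add_nonneg (hV x) (hV y)
  have hPV : ∫ u, V u ∂P x + ∫ u, V u ∂P y ≤ g * S + 2 * K := by
    have := hdrift x
    have := hdrift y
    rw [hS]; linarith
  have hbnd : b * (∫ u, V u ∂P x + ∫ u, V u ∂P y) ≤ b * (g * S + 2 * K) := by gcongr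
  rcases le_total S R with h | h
  · have h1 := abs_integral_sub_le_of_common_part (by positivity)
      (hρ x (le_max_of_le_left (by have := hV y; linarith)))
      (hρ y (le_max_of_le_left (by have := hV x; linarith))) (hf x) (hf y) hV (hint x) (hint y)
      hosc'
    refine h1.trans ?_
    have hgS : g * (b * S) ≤ (1 - δ) * (b * S) := by gcongr; linarith
    have : 2 * (1 - α) + b * (∫ u, V u ∂P x + ∫ u, V u ∂P y) ≤ (1 - δ) * (2 + b * S) := by
      nlinarith
    calc _ = c * (2 * (1 - α) + b * (∫ u, V u ∂P x + ∫ u, V u ∂P y)) := by ring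
      _ ≤ c * ((1 - δ) * (2 + b * S)) := by gcongr
      _ = _ := by ring
  · have h1 := abs_integral_sub_le_of_abs_sub_le (s := 1) (by simp) (by simp) (hf x) (hf y)
      (hint x) (hint y) hosc'
    refine h1.trans ?_
    have hKS : 8 * K ≤ (1 - g) * S := by
      have : 8 * K / (1 - g) ≤ S := by linarith
      rw [div_le_iff₀ h1g] at this
      linarith
    have hS1 : 1 ≤ S := by
      have : 0 ≤ 8 * K / (1 - g) := by positivity
      linarith
    have e1 : 2 * b * K ≤ b * (1 - g) * S / 4 := by nlinarith
    have e2 : δ * (b * S) ≤ (1 - g) / 2 * (b * S) := by gcongr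
    have e3 : 2 * δ ≤ b * (1 - g) * S / 4 := by
      have : b * (1 - g) * 1 ≤ b * (1 - g) * S := by gcongr
      linarith
    have : 2 + b * (∫ u, V u ∂P x + ∫ u, V u ∂P y) ≤ (1 - δ) * (2 + b * S) := by
      linarith
    calc _ = c * (2 + b * (∫ u, V u ∂P x + ∫ u, V u ∂P y)) := by ring
      _ ≤ c * ((1 - δ) * (2 + b * S)) := by gcongr
      _ = _ := by ring

/-- A drift function is integrable with respect to every invariant probability measure. -/
theorem integrable_of_drift {π : Measure X} [IsProbabilityMeasure π] (hVm : Measurable V)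
    (hV : ∀ x, 0 ≤ V x) (hg1 : g < 1) (hint : ∀ x, Integrable V (P x))
    (hdrift : ∀ x, ∫ u, V u ∂P x ≤ g * V x + K) (hπ : P ∘ₘ π = π) : Integrable V π := by
  have h1g : 0 < 1 - g := by linarith
  have hbd : ∀ (n : ℕ) (μ : Measure X) [IsFiniteMeasure μ],
      Integrable (fun x => min (V x) n) μ := fun n μ _ =>
    Integrable.of_bound (hVm.min measurable_const).aestronglyMeasurable (n : ℝ)
      (Filter.Eventually.of_forall fun x => by
        rw [Real.norm_of_nonneg (le_min (hV x) n.cast_nonneg)]; exact min_le_right _ _)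
  have hset : ∀ n : ℕ, MeasurableSet {x | V x ≤ n} := fun n => measurableSet_le hVm measurable_const
  have hind : ∀ n : ℕ, Integrable ({x | V x ≤ (n : ℝ)}.indicator V) π := fun n =>
    Integrable.of_bound (hVm.indicator (hset n)).aestronglyMeasurable (n : ℝ)
      (Filter.Eventually.of_forall fun x => by
        by_cases hx : V x ≤ n
        · rw [Set.indicator_of_mem (s := {x | V x ≤ (n : ℝ)}) hx, Real.norm_of_nonneg (hV x)]
          exact hx
        · rw [Set.indicator_of_notMem (s := {x | V x ≤ (n : ℝ)}) hx]
          simp)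
  have hstep : ∀ n : ℕ, ∫ x, {x | V x ≤ (n : ℝ)}.indicator V x ∂π ≤ |K| / (1 - g) := by
    intro n
    have hc : (P ∘ₖ Kernel.const Unit π) () = π := by
      rw [Kernel.comp_const, hπ, Kernel.const_apply]
    have hi : Integrable (fun x => min (V x) (n : ℝ)) ((P ∘ₖ Kernel.const Unit π) ()) := by
      rw [hc]; exact hbd n π
    have e1 : ∫ x, ∫ u, min (V u) n ∂P x ∂π = ∫ x, min (V x) n ∂π := by
      have := Kernel.integral_comp hi
      rw [hc, Kernel.const_apply] at this
      exact this.symm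
    -- By invariance the right side has `π`-integral zero. Truncating at `n` keeps that difference
    -- meaningful before `V` is known to be integrable; monotone convergence then removes the
    -- truncation.
    have hpt : ∀ x, (1 - g) * {x | V x ≤ (n : ℝ)}.indicator V x - |K| ≤
        min (V x) n - ∫ u, min (V u) n ∂P x := by
      intro x
      have a1 : ∫ u, min (V u) n ∂P x ≤ ∫ u, V u ∂P x :=
        integral_mono (hbd n (P x)) (hint x) fun u => min_le_left (V u) (n : ℝ)
      have a2 : ∫ u, min (V u) n ∂P x ≤ n := by
        have := integral_mono (hbd n (P x)) (integrable_const (n : ℝ))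
          fun u => min_le_right (V u) (n : ℝ)
        rwa [integral_const, probReal_univ, one_smul] at this
      have a3 := hdrift x
      have a4 := le_abs_self K
      by_cases hx : V x ≤ n
      · simp only [Set.indicator, Set.mem_ofPred_eq, hx, if_true, min_eq_left hx]
        linarith
      · simp only [Set.indicator, Set.mem_ofPred_eq, hx, if_false, min_eq_right (not_le.1 hx).le]
        linarith [abs_nonneg K]
    have hi2 : Integrable (fun x => ∫ u, min (V u) (n : ℝ) ∂P x) π := by
      have := hi.integral_comp
      rwa [Kernel.const_apply] at this
    have hi3 : Integrable
        (fun x => (1 - g) * {x | V x ≤ (n : ℝ)}.indicator V x - |K|) π :=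
      ((hind n).const_mul (1 - g)).sub (integrable_const _)
    have := integral_mono hi3 ((hbd n π).sub hi2) hpt
    rw [integral_sub ((hind n).const_mul _) (integrable_const _),
      integral_sub' (hbd n π) hi2, e1, integral_const_mul] at this
    rw [le_div_iff₀ h1g]
    rw [integral_const, probReal_univ, one_smul, sub_self] at this
    linarith
  refine ⟨hVm.aestronglyMeasurable, ?_⟩
  rw [hasFiniteIntegral_iff_ofReal (Filter.Eventually.of_forall hV)]
  have hsup : ∫⁻ x, ENNReal.ofReal (V x) ∂π ≤ ENNReal.ofReal (|K| / (1 - g)) := by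
    have hmono : ∀ x, ENNReal.ofReal (V x) =
        ⨆ n : ℕ, ENNReal.ofReal ({x | V x ≤ (n : ℝ)}.indicator V x) := by
      intro x
      apply le_antisymm
      · obtain ⟨n, hn⟩ := exists_nat_ge (V x)
        refine le_iSup_of_le n ?_
        simp [Set.indicator, hn]
      · refine iSup_le fun n => ENNReal.ofReal_le_ofReal ?_
        exact Set.indicator_le_self' (fun _ _ => hV x) x
    simp_rw [hmono]
    rw [lintegral_iSup (fun n => (hVm.indicator (hset n)).ennreal_ofReal)]
    · refine iSup_le fun n => ?_
      rw [← ofReal_integral_eq_lintegral_ofReal (hind n)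
        (Filter.Eventually.of_forall fun x => Set.indicator_nonneg (fun _ _ => hV _) x)]
      exact ENNReal.ofReal_le_ofReal (hstep n)
    · intro n m hnm x
      refine ENNReal.ofReal_le_ofReal ?_
      refine Set.indicator_le_indicator_of_subset (fun y hy => ?_) (fun y => hV y) x
      have hy' : V y ≤ n := hy
      exact hy'.trans (by exact_mod_cast hnm : (n : ℝ) ≤ m)
  exact hsup.trans_lt ENNReal.ofReal_lt_top

/-- **Harris' theorem**: a Markov kernel with a drift function, a minorization on the sublevel
sets of that function, and an invariant probability measure is geometrically ergodic. -/
theorem exists_tvDist_le_geometric {π : Measure X} [IsProbabilityMeasure π] (hVm : Measurable V)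
    (hV : ∀ x, 0 ≤ V x) (hg1 : g < 1) (hK : 0 ≤ K)
    (hint : ∀ x, Integrable V (P x)) (hdrift : ∀ x, ∫ u, V u ∂P x ≤ g * V x + K)
    (hminor : ∀ R : ℝ, ∃ ρ : Measure X, ρ ≠ 0 ∧ ∀ x, V x ≤ R → ρ ≤ P x)
    (hπ : P ∘ₘ π = π) (I : ℕ → Kernel X X) (hI0 : I 0 = Kernel.id)
    (hI : ∀ m, I (m + 1) = P ∘ₖ I m) :
    ∃ (C : X → ℝ) (γ : ℝ), 0 < γ ∧ γ < 1 ∧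
      ∀ (x : X) (m : ℕ), tvDist (I m x) π ≤ C x * γ ^ m := by
  obtain ⟨b, γ, hb, hγ0, hγ1, hcontr⟩ :=
    exists_oscillation_contraction hV hg1 hK hint hdrift hminor
  have hVπ := integrable_of_drift hVm hV hg1 hint hdrift hπ
  have hImk : ∀ m, IsMarkovKernel (I m) := by
    intro m
    induction m with
    | zero => rw [hI0]; infer_instance
    | succ m ih => rw [hI]; infer_instance
  -- The induction below applies the one-step contraction to `x ↦ I m x A`, so the extra step has to
  -- come first.
  have hI' : ∀ m, I (m + 1) = I m ∘ₖ P := by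
    intro m
    induction m with
    | zero => rw [hI, hI0, Kernel.comp_id, Kernel.id_comp]
    | succ m ih => rw [hI, ih, ← Kernel.comp_assoc, ← hI, ← ih]
  have hinv : ∀ m, I m ∘ₘ π = π := by
    intro m
    induction m with
    | zero => rw [hI0, Measure.id_comp]
    | succ m ih => rw [hI, ← Measure.comp_assoc, ih, hπ]
  have hcomp : ∀ (μ : Measure X) (m : ℕ) (A : Set X), MeasurableSet A →
      (I m ∘ₘ μ).real A = ∫ y, (I m y).real A ∂μ := by
    intro μ m A hA
    rw [measureReal_def, Measure.bind_apply hA (Kernel.aemeasurable _)]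
    exact (integral_toReal (Kernel.measurable_coe _ hA).aemeasurable
      (Filter.Eventually.of_forall fun y => measure_lt_top _ _)).symm
  have hintA : ∀ (μ : Measure X) [IsFiniteMeasure μ] (m : ℕ) (A : Set X), MeasurableSet A →
      Integrable (fun y => (I m y).real A) μ := by
    intro μ _ m A hA
    refine Integrable.of_bound (Kernel.measurable_coe _ hA).ennreal_toReal.aestronglyMeasurable 1
      (Filter.Eventually.of_forall fun y => ?_)
    rw [Real.norm_of_nonneg measureReal_nonneg]
    exact measureReal_le_one
  have hosc : ∀ (m : ℕ) (A : Set X), MeasurableSet A → ∀ x y,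
      |(I m x).real A - (I m y).real A| ≤ γ ^ m * (2 + b * (V x + V y)) := by
    intro m A hA
    induction m with
    | zero =>
      intro x y
      have h1 : (I 0 x).real A ≤ 1 := measureReal_le_one
      have h2 : (I 0 y).real A ≤ 1 := measureReal_le_one
      have h3 : 0 ≤ (I 0 x).real A := measureReal_nonneg
      have h4 : 0 ≤ (I 0 y).real A := measureReal_nonneg
      have h5 : 0 ≤ b * (V x + V y) := mul_nonneg hb.le (add_nonneg (hV x) (hV y))
      rw [pow_zero, one_mul, abs_le]
      constructor <;> linarith
    | succ m ih =>
      intro x y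
      have h := hcontr (fun u => (I m u).real A) (γ ^ m) (by positivity)
        (fun x => hintA (P x) m A hA) ih x y
      rw [hI' m, Kernel.comp_apply, Kernel.comp_apply, hcomp _ _ _ hA, hcomp _ _ _ hA, pow_succ]
      exact h
  refine ⟨fun x => 2 + b * (V x + ∫ y, V y ∂π), γ, hγ0, hγ1, fun x m => ?_⟩
  have : Nonempty {A : Set X // MeasurableSet A} := ⟨⟨∅, MeasurableSet.empty⟩⟩
  refine ciSup_le fun A => ?_
  obtain ⟨A, hA⟩ := A
  have hAint := hintA π m A hA
  have e : (I m x).real A - π.real A = ∫ y, ((I m x).real A - (I m y).real A) ∂π := by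
    rw [integral_sub (integrable_const _) hAint, ← hcomp _ _ _ hA, hinv]
    simp
  rw [e]
  have hi1 : Integrable (fun y => b * (V x + V y)) π :=
    ((integrable_const _).add hVπ).const_mul b
  have hi : Integrable (fun y => γ ^ m * (2 + b * (V x + V y))) π :=
    ((integrable_const _).add hi1).const_mul _
  calc |∫ y, ((I m x).real A - (I m y).real A) ∂π|
      ≤ ∫ y, |(I m x).real A - (I m y).real A| ∂π := abs_integral_le_integral_abs
    _ ≤ ∫ y, γ ^ m * (2 + b * (V x + V y)) ∂π :=
        integral_mono ((integrable_const _).sub hAint).abs hi (hosc m A hA x)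
    _ = (2 + b * (V x + ∫ y, V y ∂π)) * γ ^ m := by
        rw [integral_const_mul, integral_add (integrable_const _) hi1, integral_const_mul,
          integral_add (integrable_const _) hVπ]
        simp
        ring

end Harris

variable {p : ℕ}

/-! ### Exponential tilting of Gaussian measures -/

theorem integrable_exp_neg_mul_sq_norm {b : ℝ} (hb : 0 < b) :
    Integrable fun x : Vec p => Real.exp (-b * ‖x‖ ^ 2) := by
  have h := (GaussianFourier.integrable_cexp_neg_mul_sq_norm_add (V := Vec p)
    (show 0 < (b : ℂ).re from hb) 0 0).norm
  refine h.congr (Filter.Eventually.of_forall fun x => ?_)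
  simp only [zero_mul, add_zero]
  rw [Complex.norm_exp]
  congr 1
  norm_cast

theorem integral_exp_neg_mul_sq_norm_pos {b : ℝ} (hb : 0 < b) :
    0 < ∫ x : Vec p, Real.exp (-b * ‖x‖ ^ 2) := by
  rw [GaussianFourier.integral_rexp_neg_mul_sq_norm hb]
  positivity

/-- Both sides have the same characteristic function; the density is needed because the tilting
below is a translation of Lebesgue measure. -/
theorem stdGaussian_eq_withDensity :
    stdGaussian (Vec p) = (volume : Measure (Vec p)).withDensity fun x =>
      ENNReal.ofReal ((∫ x : Vec p, Real.exp (-(1 / 2) * ‖x‖ ^ 2))⁻¹ *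
        Real.exp (-(1 / 2) * ‖x‖ ^ 2)) := by
  set I := ∫ x : Vec p, Real.exp (-(1 / 2) * ‖x‖ ^ 2) with hI
  have hI0 : 0 < I := integral_exp_neg_mul_sq_norm_pos (by norm_num)
  have hint : Integrable fun x : Vec p => I⁻¹ * Real.exp (-(1 / 2) * ‖x‖ ^ 2) :=
    (integrable_exp_neg_mul_sq_norm (by norm_num)).const_mul _
  have hfin : IsFiniteMeasure ((volume : Measure (Vec p)).withDensity fun x =>
      ENNReal.ofReal (I⁻¹ * Real.exp (-(1 / 2) * ‖x‖ ^ 2))) :=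
    isFiniteMeasure_withDensity_ofReal hint.2
  refine Measure.ext_of_charFun ?_
  ext t
  rw [charFun_stdGaussian, charFun_apply, integral_withDensity_eq_integral_toReal_smul
    (by fun_prop) (Filter.Eventually.of_forall fun x => ENNReal.ofReal_lt_top)]
  have h2 := GaussianFourier.integral_cexp_neg_mul_sq_norm_add (V := Vec p) (b := 1 / 2)
    (by norm_num) Complex.I t
  have hIc : (I : ℂ) = (Real.pi / (1 / 2 : ℂ)) ^ (Module.finrank ℝ (Vec p) / 2 : ℂ) := by
    rw [← GaussianFourier.integral_cexp_neg_mul_sq_norm (V := Vec p) (b := 1 / 2) (by norm_num),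
      hI, ← integral_complex_ofReal]
    congr 1
    ext x
    push_cast
    rfl
  have hcongr : ∀ x : Vec p, (ENNReal.ofReal (I⁻¹ * Real.exp (-(1 / 2) * ‖x‖ ^ 2))).toReal •
      Complex.exp (inner ℝ x t * Complex.I) =
      (I : ℂ)⁻¹ * Complex.exp (-(1 / 2) * ‖x‖ ^ 2 + Complex.I * inner ℝ t x) := by
    intro x
    rw [ENNReal.toReal_ofReal (by positivity), Complex.real_smul, Complex.exp_add,
      real_inner_comm x t, mul_comm Complex.I]
    push_cast
    ring
  simp_rw [hcongr]
  rw [integral_const_mul, h2, ← hIc, ← mul_assoc, inv_mul_cancel₀ (by exact_mod_cast hI0.ne'),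
    one_mul, Complex.I_sq]
  congr 1
  ring

/-- Cameron–Martin formula: translate Lebesgue measure and expand `‖z - a‖²`. -/
theorem lintegral_stdGaussian_add (a : Vec p) {f : Vec p → ENNReal} (hf : Measurable f) :
    ∫⁻ z, f (a + z) ∂stdGaussian (Vec p) =
      ∫⁻ z, ENNReal.ofReal (Real.exp (inner ℝ a z - ‖a‖ ^ 2 / 2)) * f z
        ∂stdGaussian (Vec p) := by
  have hm : Measurable fun x : Vec p => ENNReal.ofReal
      ((∫ x : Vec p, Real.exp (-(1 / 2) * ‖x‖ ^ 2))⁻¹ * Real.exp (-(1 / 2) * ‖x‖ ^ 2)) := by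
    fun_prop
  rw [stdGaussian_eq_withDensity, lintegral_withDensity_eq_lintegral_mul _ hm (by fun_prop),
    lintegral_withDensity_eq_lintegral_mul _ hm (by fun_prop),
    ← lintegral_add_left_eq_self _ (-a)]
  refine lintegral_congr fun z => ?_
  simp only [Pi.mul_apply, add_neg_cancel_left]
  rw [← mul_assoc, ← ENNReal.ofReal_mul (by positivity), mul_assoc, ← Real.exp_add]
  congr 4
  rw [neg_add_eq_sub, norm_sub_sq_real, real_inner_comm]
  ring

-- With `T` the square root of `S`, the law is the image under `T` of a standard Gaussian shifted by
-- `T a`, and `⟨a, S a⟩ = ‖T a‖²`. No inverse of `S` is involved.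
open scoped MatrixOrder in
theorem lintegral_multivariateGaussian_tilt {S : Matrix (Fin p) (Fin p) ℝ} (hS : S.PosSemidef)
    (a : Vec p) {f : Vec p → ENNReal} (hf : Measurable f) :
    ∫⁻ z, f z ∂multivariateGaussian (Matrix.toEuclideanCLM (𝕜 := ℝ) S a) S =
      ∫⁻ z, ENNReal.ofReal (Real.exp (inner ℝ a z -
        inner ℝ a (Matrix.toEuclideanCLM (𝕜 := ℝ) S a) / 2)) * f z
        ∂multivariateGaussian 0 S := by
  set T := Matrix.toEuclideanCLM (𝕜 := ℝ) (CFC.sqrt S) with hT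
  have hTT : ∀ x, Matrix.toEuclideanCLM (𝕜 := ℝ) S x = T (T x) := by
    intro x
    conv_lhs => rw [← CFC.sqrt_mul_sqrt_self S hS.nonneg, map_mul]
    rfl
  have hsa : ∀ x y, inner ℝ x (T y) = inner ℝ (T x) y := by
    intro x y
    have : IsSelfAdjoint T := (CFC.sqrt_nonneg S).isSelfAdjoint.map _
    rw [← ContinuousLinearMap.adjoint_inner_left, this.adjoint_eq]
  rw [multivariateGaussian, multivariateGaussian, lintegral_map hf (by fun_prop),
    lintegral_map (by fun_prop) (by fun_prop)]
  simp only [← hT, zero_add, hTT, ← map_add]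
  rw [lintegral_stdGaussian_add (T a) (f := fun z => f (T z)) (by fun_prop)]
  refine lintegral_congr fun z => ?_
  rw [hsa a z, hsa a (T a), real_inner_self_eq_norm_sq]

theorem exists_integral_norm_sub_multivariateGaussian_eq (S : Matrix (Fin p) (Fin p) ℝ) :
    ∃ C : ℝ, 0 ≤ C ∧ ∀ m : Vec p, Integrable (fun z => ‖z - m‖) (multivariateGaussian m S) ∧
      ∫ z, ‖z - m‖ ∂multivariateGaussian m S = C := by
  refine ⟨∫ z, ‖z‖ ∂multivariateGaussian (0 : Vec p) S,
    integral_nonneg fun _ => norm_nonneg _, fun m => ⟨?_, ?_⟩⟩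
  · exact ((IsGaussian.integrable_id (μ := multivariateGaussian m S)).sub
      (integrable_const m)).norm
  · rw [multivariateGaussian, multivariateGaussian, integral_map (by fun_prop) (by fun_prop),
      integral_map (by fun_prop) (by fun_prop)]
    simp

/-! ### The conditional density of `β` given `(r, t)` -/

theorem spectralNorm_nonneg (A : Matrix (Fin p) (Fin p) ℝ) : 0 ≤ spectralNorm A := norm_nonneg _

theorem softThreshold_of_lt {k x : ℝ} (hk : 0 ≤ k) (hx : k < x) : softThreshold k x = x - k := by
  have hx0 : 0 < x := hk.trans_lt hx
  rw [softThreshold, Real.sign_of_pos hx0, abs_of_pos hx0, max_eq_left (by linarith), one_mul]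

theorem softThreshold_of_abs_le {k x : ℝ} (hx : |x| ≤ k) : softThreshold k x = 0 := by
  rw [softThreshold, max_eq_right (by linarith), mul_zero]

theorem softThreshold_of_lt_neg {k x : ℝ} (hk : 0 ≤ k) (hx : x < -k) :
    softThreshold k x = x + k := by
  have hx0 : x < 0 := by linarith
  rw [softThreshold, Real.sign_of_neg hx0, abs_of_neg hx0, max_eq_left (by linarith)]
  ring

theorem abs_softThreshold_sub_le {k : ℝ} (hk : 0 ≤ k) (x : ℝ) : |softThreshold k x - x| ≤ k := by
  rcases lt_or_ge k x with h | h
  · rw [softThreshold_of_lt hk h, abs_le]; constructor <;> linarith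
  rcases lt_or_ge x (-k) with h' | h'
  · rw [softThreshold_of_lt_neg hk h', abs_le]; constructor <;> linarith
  · rw [softThreshold_of_abs_le (abs_le.2 ⟨h', h⟩), zero_sub, abs_neg]
    exact abs_le.2 ⟨h', h⟩

theorem integrable_exp_neg_sub_sq {v : ℝ} (hv : 0 < v) (m : ℝ) :
    Integrable fun x : ℝ => Real.exp (-(x - m) ^ 2 / (2 * v)) := by
  have h := (integrable_exp_neg_mul_sq (b := 1 / (2 * v)) (by positivity)).comp_sub_right m
  refine h.congr (Filter.Eventually.of_forall fun x => ?_)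
  simp only
  congr 1
  ring

theorem truncMass_pos {S : Set ℝ} (hS : IsOpen S) (hne : S.Nonempty) {v : ℝ} (hv : 0 < v)
    (m : ℝ) : 0 < truncMass S m v := by
  rw [truncMass, setIntegral_pos_iff_support_of_nonneg_ae
    (Filter.Eventually.of_forall fun x => (Real.exp_pos _).le)
    (integrable_exp_neg_sub_sq hv m).integrableOn]
  have : (Function.support fun x : ℝ => Real.exp (-(x - m) ^ 2 / (2 * v))) = Set.univ :=
    Set.eq_univ_of_forall fun x => (Real.exp_pos _).ne'
  rw [this, Set.univ_inter]
  exact hS.measure_pos volume hne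

namespace Params

variable {Q : Params p}

theorem isOpen_compSupport (Q : Params p) (j : Fin p) (b : SignType) :
    IsOpen (Q.compSupport j b) := by
  cases b
  · exact isOpen_Ioo
  · exact isOpen_Iio
  · exact isOpen_Ioi

theorem compVar_pos (hd : 0 < Q.d) (he : 0 < Q.e) (b : SignType) : 0 < Q.compVar b := by
  cases b <;> simp only [compVar] <;> positivity

theorem norm_theta_sub_le (hκ : ∀ j, 0 ≤ Q.κ j) (β : Vec p) : ‖Q.theta β - β‖ ≤ ‖Q.κ‖ := by
  rw [EuclideanSpace.norm_eq, EuclideanSpace.norm_eq]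
  refine Real.sqrt_le_sqrt (Finset.sum_le_sum fun j _ => ?_)
  have := abs_softThreshold_sub_le (hκ j) (β j)
  rw [PiLp.sub_apply, Real.norm_eq_abs, Real.norm_eq_abs, abs_of_nonneg (hκ j)]
  exact pow_le_pow_left₀ (abs_nonneg _) this 2

/-! ### Factorization of the conditional law over coordinates -/

/-- Contribution of the coordinate `j` to the logarithm of the joint density. -/
def coordLog (Q : Params p) (r t : Vec p) (j : Fin p) (x : ℝ) : ℝ :=
  -(Q.d / 2) * softThreshold (Q.κ j) x ^ 2 + (Q.φ j + r j) * softThreshold (Q.κ j) x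
    - Q.e / 2 * x ^ 2 + (Q.ψ j + t j) * x

/-- Logarithm, up to a term not involving `β`, of the joint density of `(β, r, t)`. -/
def logJoint (Q : Params p) (r t β : Vec p) : ℝ :=
  -(Q.d / 2) * ‖Q.theta β‖ ^ 2 + inner ℝ (Q.φ + r) (Q.theta β)
    - Q.e / 2 * ‖β‖ ^ 2 + inner ℝ (Q.ψ + t) β

theorem logJoint_eq_sum (Q : Params p) (r t β : Vec p) :
    Q.logJoint r t β = ∑ j, Q.coordLog r t j (β j) := by
  simp only [logJoint, coordLog, EuclideanSpace.norm_sq_eq, PiLp.inner_apply, theta,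
    Finset.sum_add_distrib, Finset.sum_sub_distrib, ← Finset.mul_sum, Real.norm_eq_abs, sq_abs,
    PiLp.add_apply, RCLike.inner_apply, conj_trivial]
  congr 1
  · congr 2
    exact Finset.sum_congr rfl fun _ _ => mul_comm _ _
  · exact Finset.sum_congr rfl fun _ _ => mul_comm _ _

theorem measurable_logJoint (Q : Params p) :
    Measurable fun z : (Vec p × Vec p) × Vec p => Q.logJoint z.1.1 z.1.2 z.2 := by
  have h : Measurable fun z : (Vec p × Vec p) × Vec p => Q.theta z.2 :=
    Q.measurable_theta.comp measurable_snd
  unfold logJoint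
  fun_prop

/-- Unnormalized Gaussian piece of the component `b` of the coordinate `j`. -/
def compPiece (Q : Params p) (r t : Vec p) (j : Fin p) (b : SignType) : ℝ → ℝ :=
  (Q.compSupport j b).indicator fun x => Real.exp (Q.compExponent r t j b) *
    Real.exp (-(x - Q.compMean r t j b) ^ 2 / (2 * Q.compVar b))

theorem integrable_compPiece (hd : 0 < Q.d) (he : 0 < Q.e) (r t : Vec p) (j : Fin p)
    (b : SignType) : Integrable (Q.compPiece r t j b) :=
  ((integrable_exp_neg_sub_sq (compVar_pos hd he b) _).const_mul _).indicator
    (Q.measurableSet_compSupport j b)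

theorem integral_compPiece (Q : Params p) (r t : Vec p) (j : Fin p) (b : SignType) :
    ∫ x, Q.compPiece r t j b x = Q.compWeight r t j b := by
  rw [compPiece, integral_indicator (Q.measurableSet_compSupport j b), integral_const_mul,
    compWeight, truncMass, mul_comm]

/-- The truncation mass in the mixture weight cancels the normalization of the truncated density. A
component with empty support, as for `κ j = 0`, contributes zero to both sides. -/
theorem coordDensity_eq (hd : 0 < Q.d) (he : 0 < Q.e) (r t : Vec p) (j : Fin p) (x : ℝ) :
    Q.coordDensity r t j x =
      (∑ b : SignType, Q.compWeight r t j b)⁻¹ * ∑ b : SignType, Q.compPiece r t j b x := by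
  rw [coordDensity, Finset.mul_sum]
  refine Finset.sum_congr rfl fun b _ => ?_
  by_cases hx : x ∈ Q.compSupport j b
  · have h := (truncMass_pos (Q.isOpen_compSupport j b) ⟨x, hx⟩ (compVar_pos hd he b)
      (Q.compMean r t j b)).ne'
    rw [truncDensity, compPiece, Set.indicator_of_mem hx, Set.indicator_of_mem hx, compProb,
      compWeight]
    field_simp
  · rw [truncDensity, compPiece, Set.indicator_of_notMem hx, Set.indicator_of_notMem hx,
      mul_zero, mul_zero]

/-- Off the thresholds exactly one open support contains `x`, soft thresholding is affine there, and
completing the square gives the component. At `|x| = κ j` all pieces vanish, hence the exclusion of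
a null set. -/
theorem sum_compPiece (hd : 0 < Q.d) (he : 0 < Q.e) (hκ : ∀ j, 0 ≤ Q.κ j) (r t : Vec p)
    (j : Fin p) {x : ℝ} (hx : |x| ≠ Q.κ j) :
    ∑ b : SignType, Q.compPiece r t j b x = Real.exp (Q.coordLog r t j x) := by
  have hde : Q.d + Q.e ≠ 0 := by positivity
  have hsum : ∀ f : SignType → ℝ, ∑ b, f b = f .zero + (f .neg + f .pos) := fun f => by
    simp [Finset.sum, Finset.univ, Fintype.elems, SignType.enumList]
  have hk := hκ j
  rw [hsum]
  simp only [compPiece, compSupport, Set.indicator, Set.mem_Ioo, Set.mem_Iio, Set.mem_Ioi]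
  rcases lt_or_gt_of_ne hx with h | h
  · obtain ⟨h1, h2⟩ := abs_lt.1 h
    rw [if_pos ⟨h1, h2⟩, if_neg (by linarith), if_neg (by linarith), add_zero, add_zero,
      ← Real.exp_add, coordLog, softThreshold_of_abs_le h.le]
    simp only [compExponent, compMean, compVar]
    congr 1
    field_simp
    ring
  · rcases lt_abs.1 h with h1 | h1
    · rw [if_neg (by rintro ⟨-, h2⟩; linarith), if_neg (by linarith), if_pos h1, zero_add,
        zero_add, ← Real.exp_add, coordLog, softThreshold_of_lt hk h1]
      simp only [compExponent, compMean, compVar]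
      congr 1
      field_simp
      ring
    · rw [if_neg (by rintro ⟨h2, -⟩; linarith), if_pos (by linarith), if_neg (by linarith),
        zero_add, add_zero, ← Real.exp_add, coordLog,
        softThreshold_of_lt_neg hk (by linarith)]
      simp only [compExponent, compMean, compVar]
      congr 1
      field_simp
      ring

theorem ae_abs_ne (k : ℝ) : ∀ᵐ x : ℝ, |x| ≠ k := by
  have h : ({k, -k} : Set ℝ)ᶜ ∈ ae (volume : Measure ℝ) :=
    compl_mem_ae_iff.2 ((Set.toFinite _).measure_zero _)
  filter_upwards [h] with x hx hk
  refine hx ?_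
  rcases abs_choice x with h' | h'
  · exact Or.inl (h' ▸ hk)
  · exact Or.inr (by rw [Set.mem_singleton_iff]; linarith)

theorem integral_exp_coordLog (hd : 0 < Q.d) (he : 0 < Q.e) (hκ : ∀ j, 0 ≤ Q.κ j)
    (r t : Vec p) (j : Fin p) :
    ∫ x, Real.exp (Q.coordLog r t j x) = ∑ b : SignType, Q.compWeight r t j b := by
  have h : (fun x => Real.exp (Q.coordLog r t j x)) =ᵐ[volume]
      fun x => ∑ b : SignType, Q.compPiece r t j b x := by
    filter_upwards [ae_abs_ne (Q.κ j)] with x hx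
    rw [sum_compPiece hd he hκ r t j hx]
  rw [integral_congr_ae h, integral_finsetSum _ fun b _ => integrable_compPiece hd he r t j b]
  exact Finset.sum_congr rfl fun b _ => Q.integral_compPiece r t j b

/-- Normalizing constant of the conditional density of `β` given `(r, t)`. -/
def normConst (Q : Params p) (r t : Vec p) : ℝ := ∫ β, Real.exp (Q.logJoint r t β)

theorem normConst_eq_prod (hd : 0 < Q.d) (he : 0 < Q.e) (hκ : ∀ j, 0 ≤ Q.κ j) (r t : Vec p) :
    Q.normConst r t = ∏ j, ∑ b : SignType, Q.compWeight r t j b := by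
  simp_rw [← integral_exp_coordLog hd he hκ]
  rw [← integral_fintype_prod_volume_eq_prod (fun j x => Real.exp (Q.coordLog r t j x)), normConst,
    ← (PiLp.volume_preserving_ofLp (Fin p)).integral_comp
      (MeasurableEquiv.toLp 2 (Fin p → ℝ)).symm.measurableEmbedding]
  simp only [logJoint_eq_sum, Real.exp_sum]

theorem blockDensity_ae_eq (hd : 0 < Q.d) (he : 0 < Q.e) (hκ : ∀ j, 0 ≤ Q.κ j) (r t : Vec p) :
    Q.blockDensity r t =ᵐ[volume]
      fun β => (Q.normConst r t)⁻¹ * Real.exp (Q.logJoint r t β) := by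
  have h : ∀ᵐ β : Vec p, ∀ j, |β j| ≠ Q.κ j := by
    rw [ae_all_iff]
    intro j
    have h1 : Filter.Tendsto (fun f : Fin p → ℝ => f j) (ae volume) (ae volume) :=
      Measure.tendsto_eval_ae_ae
    exact (PiLp.volume_preserving_ofLp (Fin p)).quasiMeasurePreserving.ae
      (h1.eventually (ae_abs_ne (Q.κ j)))
  filter_upwards [h] with β hβ
  rw [blockDensity, normConst_eq_prod hd he hκ, logJoint_eq_sum, Real.exp_sum,
    ← Finset.prod_inv_distrib, ← Finset.prod_mul_distrib]
  refine Finset.prod_congr rfl fun j _ => ?_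
  rw [coordDensity_eq hd he, sum_compPiece hd he hκ r t j (hβ j)]

/-! ### Gaussian comparison of the conditional law -/

/-- Center of the Gaussian approximation to the law of `β` given `(r, t)`. -/
def center (Q : Params p) (r t : Vec p) : Vec p := (Q.d + Q.e)⁻¹ • (r + t)

/-- Replacing `θ` by `β` and dropping `φ`, `ψ` leaves a complete square about the centre. The error
is at most linear in `‖r‖` and `‖β‖`, and the part linear in `‖β - center‖` is absorbed by half of
the quadratic term. -/
theorem exists_abs_logJoint_sub_le (hd : 0 < Q.d) (he : 0 < Q.e) (hκ : ∀ j, 0 ≤ Q.κ j) :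
    ∃ C : ℝ, 0 ≤ C ∧ ∀ r t β : Vec p,
      |Q.logJoint r t β - ((Q.d + Q.e) / 2 * ‖Q.center r t‖ ^ 2 -
        (Q.d + Q.e) / 2 * ‖β - Q.center r t‖ ^ 2)| ≤
      C * (1 + ‖r‖ + ‖t‖) + (Q.d + Q.e) / 4 * ‖β - Q.center r t‖ ^ 2 := by
  set c := Q.d + Q.e with hc
  have hc0 : 0 < c := by positivity
  set k := ‖Q.κ‖ with hk
  have hk0 : 0 ≤ k := norm_nonneg _
  set a := Q.d * k + ‖Q.φ‖ + ‖Q.ψ‖ with ha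
  have ha0 : 0 ≤ a := by positivity
  refine ⟨a / c + k + (Q.d / 2 * k ^ 2 + ‖Q.φ‖ * k + a ^ 2 / c), by positivity,
    fun r t β => ?_⟩
  set μ := Q.center r t with hμ
  have hrt : r + t = c • μ := by
    rw [hμ, center, smul_smul, mul_inv_cancel₀ hc0.ne', one_smul]
  set θ := Q.theta β with hθ
  have hδ : ‖θ - β‖ ≤ k := norm_theta_sub_le hκ β
  have hμn : ‖μ‖ ≤ (‖r‖ + ‖t‖) / c := by
    rw [le_div_iff₀ hc0, mul_comm, ← Real.norm_of_nonneg hc0.le, ← norm_smul, ← hrt]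
    exact norm_add_le _ _
  have hβ : ‖β‖ ≤ ‖μ‖ + ‖β - μ‖ := by
    simpa using norm_add_le μ (β - μ)
  have hθn : ‖θ‖ ≤ ‖β‖ + k := by
    have := norm_add_le β (θ - β)
    rw [add_sub_cancel] at this
    linarith
  have herr : Q.logJoint r t β - (c / 2 * ‖μ‖ ^ 2 - c / 2 * ‖β - μ‖ ^ 2) =
      Q.d / 2 * inner ℝ (β - θ) (β + θ) + inner ℝ r (θ - β) + inner ℝ Q.φ θ
        + inner ℝ Q.ψ β := by
    have e1 : inner ℝ (r + t) β = c * inner ℝ μ β := by rw [hrt, real_inner_smul_left]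
    have e2 : inner ℝ (β - θ) (β + θ) = ‖β‖ ^ 2 - ‖θ‖ ^ 2 := by
      rw [inner_sub_left, inner_add_right, inner_add_right, real_inner_self_eq_norm_sq,
        real_inner_self_eq_norm_sq, real_inner_comm θ β]
      ring
    rw [logJoint, ← hθ, norm_sub_sq_real, e2, inner_add_left, inner_add_left, inner_sub_right,
      real_inner_comm μ β]
    rw [inner_add_left] at e1
    linear_combination e1 + (‖β‖ ^ 2 / 2) * hc
  have i1 : |inner ℝ (β - θ) (β + θ)| ≤ k * (2 * ‖β‖ + k) := by
    refine (abs_real_inner_le_norm _ _).trans (mul_le_mul ?_ ?_ (norm_nonneg _) hk0)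
    · rw [norm_sub_rev]; exact hδ
    · linarith [norm_add_le β θ]
  have i2 : |inner ℝ r (θ - β)| ≤ ‖r‖ * k :=
    (abs_real_inner_le_norm _ _).trans (by gcongr)
  have i3 : |inner ℝ Q.φ θ| ≤ ‖Q.φ‖ * (‖β‖ + k) :=
    (abs_real_inner_le_norm _ _).trans (by gcongr)
  have i4 : |inner ℝ Q.ψ β| ≤ ‖Q.ψ‖ * ‖β‖ := abs_real_inner_le_norm _ _
  have i5 : a * ‖β - μ‖ ≤ c / 4 * ‖β - μ‖ ^ 2 + a ^ 2 / c := by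
    have h : c / 4 * ‖β - μ‖ ^ 2 + a ^ 2 / c - a * ‖β - μ‖ =
        (c / 2 * ‖β - μ‖ - a) ^ 2 / c := by
      field_simp
      ring
    have : 0 ≤ (c / 2 * ‖β - μ‖ - a) ^ 2 / c := by positivity
    linarith
  have i6 : a * ‖β‖ ≤ a / c * (‖r‖ + ‖t‖) + (c / 4 * ‖β - μ‖ ^ 2 + a ^ 2 / c) := by
    calc a * ‖β‖ ≤ a * ((‖r‖ + ‖t‖) / c + ‖β - μ‖) := by gcongr; linarith
      _ = a / c * (‖r‖ + ‖t‖) + a * ‖β - μ‖ := by ring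
      _ ≤ _ := by gcongr
  have i7 : |Q.d / 2 * inner ℝ (β - θ) (β + θ)| ≤ Q.d / 2 * (k * (2 * ‖β‖ + k)) := by
    rw [abs_mul, abs_of_pos (by positivity : 0 < Q.d / 2)]
    gcongr
  rw [herr]
  have hB : 0 ≤ Q.d / 2 * k ^ 2 + ‖Q.φ‖ * k + a ^ 2 / c := by positivity
  have hA : 0 ≤ a / c := by positivity
  calc _ ≤ Q.d / 2 * (k * (2 * ‖β‖ + k)) + ‖r‖ * k + ‖Q.φ‖ * (‖β‖ + k) + ‖Q.ψ‖ * ‖β‖ := by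
        refine (abs_add_le _ _).trans (add_le_add ((abs_add_le _ _).trans (add_le_add
          ((abs_add_le _ _).trans (add_le_add i7 i2)) i3)) i4)
    _ = a * ‖β‖ + k * ‖r‖ + (Q.d / 2 * k ^ 2 + ‖Q.φ‖ * k) := by rw [ha]; ring
    _ ≤ _ := by
        have := mul_nonneg hk0 (norm_nonneg t)
        have := mul_nonneg hB (add_nonneg (norm_nonneg r) (norm_nonneg t))
        nlinarith

theorem measurable_logJoint_right (Q : Params p) (r t : Vec p) : Measurable fun β => Q.logJoint r t β := by
  have := Q.measurable_theta
  unfold logJoint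
  fun_prop

theorem integrable_exp_logJoint (hd : 0 < Q.d) (he : 0 < Q.e) (hκ : ∀ j, 0 ≤ Q.κ j)
    (r t : Vec p) : Integrable fun β => Real.exp (Q.logJoint r t β) := by
  obtain ⟨C, -, hC⟩ := exists_abs_logJoint_sub_le hd he hκ
  have hg : Integrable fun β : Vec p =>
      Real.exp ((Q.d + Q.e) / 2 * ‖Q.center r t‖ ^ 2 + C * (1 + ‖r‖ + ‖t‖)) *
        Real.exp (-((Q.d + Q.e) / 4) * ‖β - Q.center r t‖ ^ 2) :=
    ((integrable_exp_neg_mul_sq_norm (by positivity)).comp_sub_right _).const_mul _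
  refine hg.mono' (Real.measurable_exp.comp
    (Q.measurable_logJoint_right r t)).aestronglyMeasurable
    (Filter.Eventually.of_forall fun β => ?_)
  rw [Real.norm_of_nonneg (Real.exp_pos _).le, ← Real.exp_add]
  refine Real.exp_le_exp.2 ?_
  have := (abs_le.1 (hC r t β)).2
  linarith

theorem normConst_pos (hd : 0 < Q.d) (he : 0 < Q.e) (hκ : ∀ j, 0 ≤ Q.κ j) (r t : Vec p) :
    0 < Q.normConst r t :=
  integral_exp_pos (integrable_exp_logJoint hd he hκ r t)

/-- Conditional density of `β` given `(r, t)`. -/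
def condDensity (Q : Params p) (r t β : Vec p) : ℝ :=
  (Q.normConst r t)⁻¹ * Real.exp (Q.logJoint r t β)

theorem measurable_condDensity (Q : Params p) (r t : Vec p) : Measurable (Q.condDensity r t) :=
  (Real.measurable_exp.comp (Q.measurable_logJoint_right r t)).const_mul _

theorem integrable_condDensity (hd : 0 < Q.d) (he : 0 < Q.e) (hκ : ∀ j, 0 ≤ Q.κ j)
    (r t : Vec p) : Integrable (Q.condDensity r t) :=
  (integrable_exp_logJoint hd he hκ r t).const_mul _

theorem integral_condDensity (hd : 0 < Q.d) (he : 0 < Q.e) (hκ : ∀ j, 0 ≤ Q.κ j)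
    (r t : Vec p) : ∫ β, Q.condDensity r t β = 1 := by
  simp only [condDensity]
  rw [integral_const_mul]
  exact inv_mul_cancel₀ (normConst_pos hd he hκ r t).ne'

theorem condDensity_nonneg (hd : 0 < Q.d) (he : 0 < Q.e) (hκ : ∀ j, 0 ≤ Q.κ j)
    (r t β : Vec p) : 0 ≤ Q.condDensity r t β :=
  mul_nonneg (inv_nonneg.2 (normConst_pos hd he hκ r t).le) (Real.exp_pos _).le

theorem betaKernel_eq (hd : 0 < Q.d) (he : 0 < Q.e) (hκ : ∀ j, 0 ≤ Q.κ j) (r t : Vec p) :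
    Q.betaKernel (r, t) = (volume : Measure (Vec p)).withDensity
      fun β => ENNReal.ofReal (Q.condDensity r t β) := by
  refine withDensity_congr_ae ?_
  filter_upwards [blockDensity_ae_eq hd he hκ r t] with β hβ
  simp only [condDensity]
  rw [hβ]

theorem isMarkovKernel_betaKernel (hd : 0 < Q.d) (he : 0 < Q.e) (hκ : ∀ j, 0 ≤ Q.κ j) :
    IsMarkovKernel Q.betaKernel := by
  refine ⟨fun ⟨r, t⟩ => ⟨?_⟩⟩
  rw [betaKernel_eq hd he hκ, withDensity_apply _ MeasurableSet.univ, Measure.restrict_univ,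
    ← ofReal_integral_eq_lintegral_ofReal (integrable_condDensity hd he hκ r t)
      (Filter.Eventually.of_forall (condDensity_nonneg hd he hκ r t)),
    integral_condDensity hd he hκ, ENNReal.ofReal_one]

/-- Two-sided Gaussian bounds for the conditional density of `β`. -/
theorem exists_condDensity_bounds (hd : 0 < Q.d) (he : 0 < Q.e) (hκ : ∀ j, 0 ≤ Q.κ j) :
    ∃ C D₁ D₂ : ℝ, 0 ≤ C ∧ 0 < D₁ ∧ 0 < D₂ ∧ ∀ r t β : Vec p,
      D₁ * Real.exp (-(C * (1 + ‖r‖ + ‖t‖))) *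
          Real.exp (-(3 * (Q.d + Q.e) / 4) * ‖β - Q.center r t‖ ^ 2) ≤ Q.condDensity r t β ∧
      Q.condDensity r t β ≤ D₂ * Real.exp (C * (1 + ‖r‖ + ‖t‖)) *
          Real.exp (-((Q.d + Q.e) / 4) * ‖β - Q.center r t‖ ^ 2) := by
  obtain ⟨C, hC0, hC⟩ := exists_abs_logJoint_sub_le hd he hκ
  set c := Q.d + Q.e with hc
  have hc0 : 0 < c := by positivity
  set N : ℝ → ℝ := fun b => ∫ x : Vec p, Real.exp (-b * ‖x‖ ^ 2) with hN
  have hNpos : ∀ b, 0 < b → 0 < N b := fun b hb => integral_exp_neg_mul_sq_norm_pos hb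
  refine ⟨2 * C, (N (c / 4))⁻¹, (N (3 * c / 4))⁻¹, by positivity,
    inv_pos.2 (hNpos _ (by positivity)), inv_pos.2 (hNpos _ (by positivity)), fun r t β => ?_⟩
  set μ := Q.center r t with hμ
  set E := C * (1 + ‖r‖ + ‖t‖) with hE
  set A := c / 2 * ‖μ‖ ^ 2 with hA
  have hup : ∀ β, Real.exp (Q.logJoint r t β) ≤
      Real.exp (A + E) * Real.exp (-(c / 4) * ‖β - μ‖ ^ 2) := fun β => by
    rw [← Real.exp_add]
    refine Real.exp_le_exp.2 ?_
    have := (abs_le.1 (hC r t β)).2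
    linarith
  have hlo : ∀ β, Real.exp (A - E) * Real.exp (-(3 * c / 4) * ‖β - μ‖ ^ 2) ≤
      Real.exp (Q.logJoint r t β) := fun β => by
    rw [← Real.exp_add]
    refine Real.exp_le_exp.2 ?_
    have := (abs_le.1 (hC r t β)).1
    linarith
  have hint : ∀ b, 0 < b → ∀ s : ℝ,
      Integrable fun β : Vec p => s * Real.exp (-b * ‖β - μ‖ ^ 2) := fun b hb s =>
    ((integrable_exp_neg_mul_sq_norm hb).comp_sub_right μ).const_mul s
  have hval : ∀ b s : ℝ, ∫ β : Vec p, s * Real.exp (-b * ‖β - μ‖ ^ 2) = s * N b := fun b s => by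
    rw [integral_const_mul, integral_sub_right_eq_self (fun x => Real.exp (-b * ‖x‖ ^ 2)) μ]
  have hWup : Q.normConst r t ≤ Real.exp (A + E) * N (c / 4) := by
    rw [← hval]
    exact integral_mono (integrable_exp_logJoint hd he hκ r t) (hint _ (by positivity) _) hup
  have hWlo : Real.exp (A - E) * N (3 * c / 4) ≤ Q.normConst r t := by
    rw [← hval]
    exact integral_mono (hint _ (by positivity) _) (integrable_exp_logJoint hd he hκ r t) hlo
  have hW := normConst_pos hd he hκ r t
  have hN1 := hNpos (c / 4) (by positivity)
  have hN2 := hNpos (3 * c / 4) (by positivity)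
  constructor
  · rw [condDensity, ← div_eq_inv_mul (Real.exp (Q.logJoint r t β)), le_div_iff₀ hW]
    calc _ ≤ (N (c / 4))⁻¹ * Real.exp (-(2 * C * (1 + ‖r‖ + ‖t‖))) *
          Real.exp (-(3 * c / 4) * ‖β - μ‖ ^ 2) * (Real.exp (A + E) * N (c / 4)) := by
          gcongr
      _ = Real.exp (-(2 * C * (1 + ‖r‖ + ‖t‖))) * Real.exp (A + E) *
          Real.exp (-(3 * c / 4) * ‖β - μ‖ ^ 2) := by field_simp
      _ = Real.exp (A - E) * Real.exp (-(3 * c / 4) * ‖β - μ‖ ^ 2) := by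
          rw [← Real.exp_add]
          congr 2
          rw [hE]; ring
      _ ≤ _ := hlo β
  · rw [condDensity, ← div_eq_inv_mul (Real.exp (Q.logJoint r t β)), div_le_iff₀ hW]
    calc _ ≤ Real.exp (A + E) * Real.exp (-(c / 4) * ‖β - μ‖ ^ 2) := hup β
      _ = Real.exp (2 * C * (1 + ‖r‖ + ‖t‖)) * Real.exp (A - E) *
          Real.exp (-(c / 4) * ‖β - μ‖ ^ 2) := by
          have : Real.exp (2 * C * (1 + ‖r‖ + ‖t‖)) * Real.exp (A - E) = Real.exp (A + E) := by
            rw [← Real.exp_add]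
            congr 1
            rw [hE]; ring
          rw [this]
      _ = (N (3 * c / 4))⁻¹ * Real.exp (2 * C * (1 + ‖r‖ + ‖t‖)) *
          Real.exp (-(c / 4) * ‖β - μ‖ ^ 2) * (Real.exp (A - E) * N (3 * c / 4)) := by
          linear_combination (-(Real.exp (2 * C * (1 + ‖r‖ + ‖t‖)) * Real.exp (A - E) *
            Real.exp (-(c / 4) * ‖β - μ‖ ^ 2))) * inv_mul_cancel₀ hN2.ne'
      _ ≤ _ := by gcongr

/-- Second moment of `β` about its center, given `(r, t)`. -/
theorem exists_integral_sq_norm_sub_center_le (hd : 0 < Q.d) (he : 0 < Q.e)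
    (hκ : ∀ j, 0 ≤ Q.κ j) :
    ∃ C : ℝ, 0 ≤ C ∧ ∀ r t : Vec p,
      Integrable (fun β => ‖β - Q.center r t‖ ^ 2) (Q.betaKernel (r, t)) ∧
      ∫ β, ‖β - Q.center r t‖ ^ 2 ∂Q.betaKernel (r, t) ≤ C * (1 + ‖r‖ + ‖t‖) := by
  obtain ⟨C, D₁, D₂, hC0, hD1, hD2, hb⟩ := exists_condDensity_bounds hd he hκ
  set c := Q.d + Q.e with hc
  have hc0 : 0 < c := by positivity
  set N := ∫ x : Vec p, Real.exp (-(c / 8) * ‖x‖ ^ 2) with hN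
  have hN0 : 0 < N := integral_exp_neg_mul_sq_norm_pos (by positivity)
  refine ⟨8 / c * (C + D₂ * N), by positivity, fun r t => ?_⟩
  set μ := Q.center r t with hμ
  set L := C * (1 + ‖r‖ + ‖t‖) with hL
  have hpt : ∀ β, Q.condDensity r t β * ‖β - μ‖ ^ 2 ≤
      8 / c * (L * Q.condDensity r t β + D₂ * Real.exp (-(c / 8) * ‖β - μ‖ ^ 2)) := by
    intro β
    have h0 := condDensity_nonneg hd he hκ r t β
    -- From `u ≤ L + exp (u - L)`: the factor `exp (-L)` cancels the `exp L` of the upper density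
    -- bound, which turns an exponentially poor constant into a moment bound linear in `L`.
    have h1 : c / 8 * ‖β - μ‖ ^ 2 ≤ L + Real.exp (c / 8 * ‖β - μ‖ ^ 2 - L) := by
      have := Real.add_one_le_exp (c / 8 * ‖β - μ‖ ^ 2 - L)
      linarith
    have h2 : Q.condDensity r t β * Real.exp (c / 8 * ‖β - μ‖ ^ 2 - L) ≤
        D₂ * Real.exp (-(c / 8) * ‖β - μ‖ ^ 2) := by
      calc _ ≤ D₂ * Real.exp L * Real.exp (-(c / 4) * ‖β - μ‖ ^ 2) *
            Real.exp (c / 8 * ‖β - μ‖ ^ 2 - L) := by gcongr; exact (hb r t β).2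
        _ = _ := by
          rw [mul_assoc, mul_assoc, ← Real.exp_add, ← Real.exp_add]
          congr 2
          ring
    calc Q.condDensity r t β * ‖β - μ‖ ^ 2
        = 8 / c * (Q.condDensity r t β * (c / 8 * ‖β - μ‖ ^ 2)) := by field_simp
      _ ≤ 8 / c * (Q.condDensity r t β * (L + Real.exp (c / 8 * ‖β - μ‖ ^ 2 - L))) := by gcongr
      _ ≤ _ := by
        gcongr
        linarith
  have hi1 : Integrable fun β : Vec p => Real.exp (-(c / 8) * ‖β - μ‖ ^ 2) :=
    (integrable_exp_neg_mul_sq_norm (by positivity)).comp_sub_right μ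
  have hi2 : Integrable fun β : Vec p => D₂ * Real.exp (-(c / 8) * ‖β - μ‖ ^ 2) :=
    hi1.const_mul _
  have hi3 : Integrable fun β : Vec p => L * Q.condDensity r t β :=
    (integrable_condDensity hd he hκ r t).const_mul _
  have hi4 : Integrable fun β : Vec p =>
      8 / c * (L * Q.condDensity r t β + D₂ * Real.exp (-(c / 8) * ‖β - μ‖ ^ 2)) :=
    (hi3.add hi2).const_mul _
  have hi5 : Integrable fun β : Vec p => Q.condDensity r t β * ‖β - μ‖ ^ 2 := by
    refine hi4.mono' ?_ (Filter.Eventually.of_forall fun β => ?_)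
    · exact ((Q.measurable_condDensity r t).mul (by fun_prop)).aestronglyMeasurable
    · rw [Real.norm_of_nonneg (mul_nonneg (condDensity_nonneg hd he hκ r t β) (by positivity))]
      exact hpt β
  have hconv : ∀ β, (ENNReal.ofReal (Q.condDensity r t β)).toReal • ‖β - μ‖ ^ 2 =
      Q.condDensity r t β * ‖β - μ‖ ^ 2 := fun β => by
    rw [ENNReal.toReal_ofReal (condDensity_nonneg hd he hκ r t β), smul_eq_mul]
  rw [betaKernel_eq hd he hκ]
  constructor
  · rw [integrable_withDensity_iff_integrable_smul'
      (Q.measurable_condDensity r t).ennreal_ofReal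
      (Filter.Eventually.of_forall fun _ => ENNReal.ofReal_lt_top)]
    simpa only [hconv] using hi5
  · rw [integral_withDensity_eq_integral_toReal_smul
      (Q.measurable_condDensity r t).ennreal_ofReal
      (Filter.Eventually.of_forall fun _ => ENNReal.ofReal_lt_top)]
    simp only [hconv]
    refine (integral_mono hi5 hi4 hpt).trans ?_
    rw [integral_const_mul, integral_add hi3 hi2, integral_const_mul, integral_const_mul,
      integral_condDensity hd he hκ,
      integral_sub_right_eq_self (fun x => Real.exp (-(c / 8) * ‖x‖ ^ 2)) μ,
      mul_assoc (8 / c) (C + D₂ * N)]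
    have : D₂ * N ≤ D₂ * N * (1 + ‖r‖ + ‖t‖) := by
      have := mul_nonneg (mul_nonneg hD2.le hN0.le) (add_nonneg (norm_nonneg r) (norm_nonneg t))
      linarith
    have h8 : 0 < 8 / c := by positivity
    refine mul_le_mul_of_nonneg_left ?_ h8.le
    linarith

/-- Uniform lower bound of the draw of `β` for `(r, t)` in a bounded set. -/
theorem exists_le_betaKernel (hd : 0 < Q.d) (he : 0 < Q.e) (hκ : ∀ j, 0 ≤ Q.κ j) (R : ℝ) :
    ∃ ρ : Measure (Vec p), ρ ≠ 0 ∧ ∀ r t : Vec p, ‖r‖ + ‖t‖ ≤ R → ρ ≤ Q.betaKernel (r, t) := by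
  obtain ⟨C, D₁, D₂, hC0, hD1, hD2, hb⟩ := exists_condDensity_bounds hd he hκ
  have hc0 : 0 < Q.d + Q.e := by positivity
  set B : ℝ := (1 + |R| / (Q.d + Q.e)) ^ 2 with hB
  set ε : ℝ := D₁ * Real.exp (-(C * (1 + |R|))) *
    Real.exp (-(3 * (Q.d + Q.e) / 4) * B) with hε
  have hε0 : 0 < ε := by positivity
  refine ⟨(volume : Measure (Vec p)).withDensity
    ((Metric.ball 0 1).indicator fun _ => ENNReal.ofReal ε), ?_, fun r t hrt => ?_⟩
  · intro h
    have h1 := congrArg (fun μ : Measure (Vec p) => μ Set.univ) h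
    simp only [withDensity_apply _ MeasurableSet.univ, Measure.restrict_univ,
      Measure.coe_zero, Pi.zero_apply] at h1
    rw [lintegral_indicator measurableSet_ball, setLIntegral_const, mul_eq_zero] at h1
    rcases h1 with h1 | h1
    · exact (ENNReal.ofReal_pos.2 hε0).ne' h1
    · exact (Metric.measure_ball_pos volume (0 : Vec p) one_pos).ne' h1
  · rw [betaKernel_eq hd he hκ]
    refine withDensity_mono (Filter.Eventually.of_forall fun β => ?_)
    by_cases hβ : β ∈ Metric.ball (0 : Vec p) 1
    · rw [Set.indicator_of_mem hβ]
      refine ENNReal.ofReal_le_ofReal (le_trans ?_ (hb r t β).1)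
      have hR : ‖r‖ + ‖t‖ ≤ |R| := hrt.trans (le_abs_self R)
      have hμ : ‖Q.center r t‖ ≤ |R| / (Q.d + Q.e) := by
        rw [center, norm_smul, norm_inv, Real.norm_of_nonneg hc0.le, ← div_eq_inv_mul]
        gcongr
        exact (norm_add_le r t).trans hR
      have hsub : ‖β - Q.center r t‖ ^ 2 ≤ B := by
        rw [hB]
        refine pow_le_pow_left₀ (norm_nonneg _) ((norm_sub_le _ _).trans ?_) 2
        have : ‖β‖ < 1 := by simpa using hβ
        linarith
      rw [hε]
      have e1 : Real.exp (-(C * (1 + |R|))) ≤ Real.exp (-(C * (1 + ‖r‖ + ‖t‖))) := by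
        refine Real.exp_le_exp.2 (neg_le_neg (mul_le_mul_of_nonneg_left ?_ hC0))
        linarith
      have e2 : Real.exp (-(3 * (Q.d + Q.e) / 4) * B) ≤
          Real.exp (-(3 * (Q.d + Q.e) / 4) * ‖β - Q.center r t‖ ^ 2) := by
        refine Real.exp_le_exp.2 (mul_le_mul_of_nonpos_left hsub ?_)
        linarith
      gcongr
    · rw [Set.indicator_of_notMem hβ]
      exact zero_le
end Params

/-! ### Invariance of the target -/

theorem inner_toEuclideanCLM_le (A : Matrix (Fin p) (Fin p) ℝ) (x : Vec p) :
    inner ℝ x (Matrix.toEuclideanCLM (𝕜 := ℝ) A x) ≤ spectralNorm A * ‖x‖ ^ 2 := by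
  calc _ ≤ ‖x‖ * ‖Matrix.toEuclideanCLM (𝕜 := ℝ) A x‖ := real_inner_le_norm _ _
    _ ≤ ‖x‖ * (spectralNorm A * ‖x‖) := by
      gcongr
      exact ContinuousLinearMap.le_opNorm _ _
    _ = _ := by ring

theorem toEuclideanCLM_smul_one_sub (s : ℝ) (A : Matrix (Fin p) (Fin p) ℝ) (x : Vec p) :
    Matrix.toEuclideanCLM (𝕜 := ℝ) (s • (1 : Matrix (Fin p) (Fin p) ℝ) - A) x =
      s • x - Matrix.toEuclideanCLM (𝕜 := ℝ) A x := by
  rw [map_sub, map_smul, map_one]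
  rfl

theorem posSemidef_smul_one_sub {s : ℝ} {A : Matrix (Fin p) (Fin p) ℝ} (hA : A.PosSemidef)
    (hs : spectralNorm A < s) : (s • (1 : Matrix (Fin p) (Fin p) ℝ) - A).PosSemidef := by
  refine Matrix.PosSemidef.of_dotProduct_mulVec_nonneg ?_ fun x => ?_
  · refine Matrix.IsHermitian.sub ?_ hA.1
    rw [Matrix.IsHermitian, Matrix.conjTranspose_smul, Matrix.conjTranspose_one, star_trivial]
  · have h := Matrix.inner_toEuclideanCLM (s • (1 : Matrix (Fin p) (Fin p) ℝ) - A)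
      (WithLp.toLp 2 x) (WithLp.toLp 2 x)
    rw [star_trivial]
    refine le_of_le_of_eq ?_ h
    rw [toEuclideanCLM_smul_one_sub, inner_sub_right, real_inner_smul_right,
      real_inner_self_eq_norm_sq, sub_nonneg]
    refine (inner_toEuclideanCLM_le A _).trans ?_
    gcongr

theorem inner_toEuclideanCLM_nonneg {A : Matrix (Fin p) (Fin p) ℝ} (hA : A.PosSemidef)
    (x : Vec p) : 0 ≤ inner ℝ x (Matrix.toEuclideanCLM (𝕜 := ℝ) A x) := by
  rw [Matrix.inner_toEuclideanCLM]
  have := hA.dotProduct_mulVec_nonneg x.ofLp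
  rwa [star_trivial] at this

namespace Params
variable {Q : Params p}

/-- Density of the draw of `(r, t)` given `β` relative to the one for `θ = β = 0`. -/
def tilt (Q : Params p) (β r t : Vec p) : ℝ :=
  Real.exp (inner ℝ (Q.theta β) r - inner ℝ (Q.theta β) (Matrix.toEuclideanCLM (𝕜 := ℝ)
      (Q.d • (1 : Matrix (Fin p) (Fin p) ℝ) - Q.M) (Q.theta β)) / 2) *
    Real.exp (inner ℝ β t - inner ℝ β (Matrix.toEuclideanCLM (𝕜 := ℝ)
      (Q.e • (1 : Matrix (Fin p) (Fin p) ℝ) - Q.H) β) / 2)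

/-- The law of `(r, t)` for `θ = β = 0`. -/
def baseRT (Q : Params p) : Measure (Vec p × Vec p) :=
  (multivariateGaussian 0 (Q.d • (1 : Matrix (Fin p) (Fin p) ℝ) - Q.M)).prod
    (multivariateGaussian 0 (Q.e • (1 : Matrix (Fin p) (Fin p) ℝ) - Q.H))

instance (Q : Params p) : IsProbabilityMeasure Q.baseRT := by
  unfold baseRT; infer_instance

theorem measurable_tilt (Q : Params p) :
    Measurable fun z : Vec p × (Vec p × Vec p) => Q.tilt z.1 z.2.1 z.2.2 := by
  have h : Measurable fun z : Vec p × (Vec p × Vec p) => Q.theta z.1 :=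
    Q.measurable_theta.comp measurable_fst
  unfold tilt
  fun_prop

theorem measurable_posteriorKernel (Q : Params p) : Measurable Q.posteriorKernel := by
  have h := Q.measurable_theta
  unfold posteriorKernel
  fun_prop

/-- The anti-correlation identity: the tilt contributes `θ'Mθ/2` and `β'Hβ/2`, which cancel the
quadratic forms of the posterior and leave only multiples of `‖θ‖²` and `‖β‖²`. -/
theorem posteriorKernel_mul_tilt (Q : Params p) (β r t : Vec p) :
    Q.posteriorKernel β * Q.tilt β r t = Real.exp (Q.logJoint r t β) := by
  rw [posteriorKernel, tilt, ← Real.exp_add, ← Real.exp_add, ← Real.exp_add, logJoint,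
    toEuclideanCLM_smul_one_sub, toEuclideanCLM_smul_one_sub, inner_sub_right, inner_sub_right,
    real_inner_smul_right, real_inner_smul_right, real_inner_self_eq_norm_sq,
    real_inner_self_eq_norm_sq, inner_add_left, inner_add_left, real_inner_comm r,
    real_inner_comm t]
  congr 1
  ring

theorem rtKernel_apply (Q : Params p) (β : Vec p) :
    Q.rtKernel β = (multivariateGaussian (Matrix.toEuclideanCLM (𝕜 := ℝ)
      (Q.d • (1 : Matrix (Fin p) (Fin p) ℝ) - Q.M) (Q.theta β))
        (Q.d • (1 : Matrix (Fin p) (Fin p) ℝ) - Q.M)).prod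
      (multivariateGaussian (Matrix.toEuclideanCLM (𝕜 := ℝ)
        (Q.e • (1 : Matrix (Fin p) (Fin p) ℝ) - Q.H) β)
        (Q.e • (1 : Matrix (Fin p) (Fin p) ℝ) - Q.H)) := by
  rw [rtKernel, Kernel.prod_apply]
  rfl

instance (Q : Params p) : IsMarkovKernel Q.rtKernel := by
  unfold rtKernel; infer_instance

theorem lintegral_rtKernel (hM : Q.M.PosSemidef) (hH : Q.H.PosSemidef)
    (hd : spectralNorm Q.M < Q.d) (he : spectralNorm Q.H < Q.e) (β : Vec p)
    {f : Vec p × Vec p → ENNReal} (hf : Measurable f) :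
    ∫⁻ x, f x ∂Q.rtKernel β =
      ∫⁻ x, ENNReal.ofReal (Q.tilt β x.1 x.2) * f x ∂Q.baseRT := by
  have hg : Measurable fun x : Vec p × Vec p => ENNReal.ofReal (Q.tilt β x.1 x.2) * f x :=
    ((Q.measurable_tilt.comp (measurable_const.prodMk measurable_id : Measurable
      fun x : Vec p × Vec p => (β, x))).ennreal_ofReal).mul hf
  rw [rtKernel_apply, baseRT, lintegral_prod _ hf.aemeasurable, lintegral_prod _ hg.aemeasurable,
    lintegral_multivariateGaussian_tilt (posSemidef_smul_one_sub hM hd) _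
      hf.lintegral_prod_right']
  refine lintegral_congr fun r => ?_
  rw [lintegral_multivariateGaussian_tilt (posSemidef_smul_one_sub hH he) _
      (f := fun t => f (r, t)) (hf.comp measurable_prodMk_left),
    ← lintegral_const_mul _ (by fun_prop)]
  refine lintegral_congr fun t => ?_
  rw [tilt, ENNReal.ofReal_mul (Real.exp_pos _).le, mul_assoc]

theorem posteriorKernel_pos (Q : Params p) (β : Vec p) : 0 < Q.posteriorKernel β := by
  unfold posteriorKernel; positivity

theorem lintegral_posteriorKernel_ne_zero (Q : Params p) :
    ∫⁻ β, ENNReal.ofReal (Q.posteriorKernel β) ≠ 0 := by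
  rw [Ne, lintegral_eq_zero_iff Q.measurable_posteriorKernel.ennreal_ofReal]
  intro h
  have h1 : ∀ᵐ β : Vec p, False := by
    filter_upwards [h] with β hβ
    exact (ENNReal.ofReal_pos.2 (Q.posteriorKernel_pos β)).ne' hβ
  rw [Filter.eventually_false_iff_eq_bot, ae_eq_bot] at h1
  exact NeZero.ne (volume : Measure (Vec p)) h1

theorem lintegral_posteriorKernel_ne_top (hQ : Integrable Q.posteriorKernel) :
    ∫⁻ β, ENNReal.ofReal (Q.posteriorKernel β) ≠ ⊤ := by
  rw [← ofReal_integral_eq_lintegral_ofReal hQ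
    (Filter.Eventually.of_forall fun β => (Q.posteriorKernel_pos β).le)]
  exact ENNReal.ofReal_ne_top

theorem isProbabilityMeasure_posterior (hQ : Integrable Q.posteriorKernel) :
    IsProbabilityMeasure Q.posterior := by
  constructor
  rw [posterior, Measure.smul_apply, withDensity_apply _ MeasurableSet.univ,
    Measure.restrict_univ, smul_eq_mul]
  exact ENNReal.inv_mul_cancel Q.lintegral_posteriorKernel_ne_zero
    (lintegral_posteriorKernel_ne_top hQ)

theorem measurable_joint (Q : Params p) : Measurable
    fun z : Vec p × (Vec p × Vec p) => ENNReal.ofReal (Real.exp (Q.logJoint z.2.1 z.2.2 z.1)) :=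
  (Real.measurable_exp.comp (Q.measurable_logJoint.comp measurable_swap)).ennreal_ofReal

/-- Bayes' rule: up to normalization `G` is the joint density of `β` and `(r, t)`. Its integral over
`(r, t)` is the posterior kernel (`hmass`), its normalized section in `β` is `betaKernel` (`hcond`),
and Tonelli exchanges the two. -/
theorem betaKernel_comp_target (hM : Q.M.PosSemidef) (hH : Q.H.PosSemidef)
    (hκ : ∀ j, 0 ≤ Q.κ j) (hd : spectralNorm Q.M < Q.d) (he : spectralNorm Q.H < Q.e) :
    Q.betaKernel ∘ₘ Q.target = Q.posterior := by
  have hd0 : 0 < Q.d := (spectralNorm_nonneg _).trans_lt hd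
  have he0 : 0 < Q.e := (spectralNorm_nonneg _).trans_lt he
  obtain ⟨G, hG⟩ : ∃ G : Vec p → Vec p × Vec p → ENNReal,
      ∀ β x, G β x = ENNReal.ofReal (Real.exp (Q.logJoint x.1 x.2 β)) := ⟨_, fun _ _ => rfl⟩
  have hGm : Measurable fun z : Vec p × (Vec p × Vec p) => G z.1 z.2 := by
    simp only [hG]
    exact Q.measurable_joint
  have hfac : ∀ β x, ENNReal.ofReal (Q.posteriorKernel β) *
      ENNReal.ofReal (Q.tilt β x.1 x.2) = G β x := fun β x => by
    rw [← ENNReal.ofReal_mul (Q.posteriorKernel_pos β).le, posteriorKernel_mul_tilt, hG]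
  have htm : ∀ β, Measurable fun x : Vec p × Vec p => ENNReal.ofReal (Q.tilt β x.1 x.2) :=
    fun β => (Q.measurable_tilt.comp (measurable_const.prodMk measurable_id : Measurable
      fun x : Vec p × Vec p => (β, x))).ennreal_ofReal
  refine Measure.ext fun A hA => ?_
  have hF : Measurable fun x => Q.betaKernel x A := Kernel.measurable_coe _ hA
  have hmass : ∀ β, ∫⁻ x, G β x ∂Q.baseRT = ENNReal.ofReal (Q.posteriorKernel β) := by
    intro β
    have h1 := lintegral_rtKernel hM hH hd he β (f := fun _ => 1) measurable_const
    simp only [lintegral_const, measure_univ, mul_one] at h1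
    simp_rw [← hfac]
    rw [lintegral_const_mul _ (htm β), ← h1, mul_one]
  have hcond : ∀ x : Vec p × Vec p,
      (∫⁻ β, G β x) * Q.betaKernel x A = ∫⁻ β in A, G β x := by
    rintro ⟨r, t⟩
    have hW := normConst_pos hd0 he0 hκ r t
    simp only [hG]
    have e1 : ∫⁻ β, ENNReal.ofReal (Real.exp (Q.logJoint r t β)) = ENNReal.ofReal (Q.normConst r t) :=
      (ofReal_integral_eq_lintegral_ofReal (integrable_exp_logJoint hd0 he0 hκ r t)
        (Filter.Eventually.of_forall fun β => (Real.exp_pos _).le)).symm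
    rw [e1, betaKernel_eq hd0 he0 hκ, withDensity_apply _ hA, ← lintegral_const_mul _
      (Q.measurable_condDensity r t).ennreal_ofReal]
    refine lintegral_congr fun β => ?_
    rw [← ENNReal.ofReal_mul hW.le, condDensity, mul_inv_cancel_left₀ hW.ne']
  rw [Measure.bind_apply hA (Kernel.aemeasurable _), target,
    Measure.lintegral_bind (Kernel.aemeasurable _) hF.aemeasurable, posterior,
    lintegral_smul_measure, Measure.smul_apply, withDensity_apply _ hA]
  congr 1
  have hrt : Measurable fun β => ∫⁻ x, Q.betaKernel x A ∂Q.rtKernel β := hF.lintegral_kernel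
  rw [lintegral_withDensity_eq_lintegral_mul _ Q.measurable_posteriorKernel.ennreal_ofReal hrt]
  have hGF : Measurable fun z : Vec p × (Vec p × Vec p) => G z.1 z.2 * Q.betaKernel z.2 A :=
    hGm.mul (hF.comp measurable_snd)
  calc _ = ∫⁻ β, ∫⁻ x, G β x * Q.betaKernel x A ∂Q.baseRT := by
        refine lintegral_congr fun β => ?_
        have hm : Measurable fun x => ENNReal.ofReal (Q.tilt β x.1 x.2) * Q.betaKernel x A :=
          (htm β).mul hF
        rw [Pi.mul_apply, lintegral_rtKernel hM hH hd he β hF, ← lintegral_const_mul _ hm]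
        refine lintegral_congr fun x => ?_
        rw [← mul_assoc, hfac]
    _ = ∫⁻ x, (∫⁻ β, G β x * Q.betaKernel x A) ∂Q.baseRT :=
        lintegral_lintegral_swap hGF.aemeasurable
    _ = ∫⁻ x, (∫⁻ β in A, G β x) ∂Q.baseRT := by
        refine lintegral_congr fun x => ?_
        have hm : Measurable fun β => G β x := hGm.comp measurable_prodMk_right
        rw [lintegral_mul_const _ hm, hcond]
    _ = ∫⁻ β in A, ∫⁻ x, G β x ∂Q.baseRT :=
        lintegral_lintegral_swap (hGm.comp measurable_swap).aemeasurable
    _ = _ := by simp_rw [hmass]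

theorem step_comp_target (hM : Q.M.PosSemidef) (hH : Q.H.PosSemidef)
    (hκ : ∀ j, 0 ≤ Q.κ j) (hd : spectralNorm Q.M < Q.d) (he : spectralNorm Q.H < Q.e) :
    Q.step ∘ₘ Q.target = Q.target := by
  rw [step, ← Measure.comp_assoc, betaKernel_comp_target hM hH hκ hd he, target]

end Params

/-! ### Contraction of the conditional mean -/

theorem inner_toEuclideanCLM_comm {A : Matrix (Fin p) (Fin p) ℝ} (hA : A.IsHermitian)
    (x y : Vec p) : inner ℝ x (Matrix.toEuclideanCLM (𝕜 := ℝ) A y) =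
      inner ℝ (Matrix.toEuclideanCLM (𝕜 := ℝ) A x) y := by
  have : IsSelfAdjoint (Matrix.toEuclideanCLM (𝕜 := ℝ) A) :=
    IsSelfAdjoint.map (show IsSelfAdjoint A from hA) _
  rw [← ContinuousLinearMap.adjoint_inner_left, this.adjoint_eq]

/-- This is `A² ≤ cA`, read off from the nonnegativity of the form of `A` at `c • x - A x`, without
diagonalization. -/
theorem sq_norm_toEuclideanCLM_le {A : Matrix (Fin p) (Fin p) ℝ} (hA : A.PosSemidef) {c : ℝ}
    (hc : 0 < c) (hAc : spectralNorm A ≤ c) (x : Vec p) :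
    ‖Matrix.toEuclideanCLM (𝕜 := ℝ) A x‖ ^ 2 ≤
      c * inner ℝ x (Matrix.toEuclideanCLM (𝕜 := ℝ) A x) := by
  set y := Matrix.toEuclideanCLM (𝕜 := ℝ) A x with hy
  have h := inner_toEuclideanCLM_nonneg hA (c • x - y)
  have h2 : inner ℝ y (Matrix.toEuclideanCLM (𝕜 := ℝ) A y) ≤ c * ‖y‖ ^ 2 :=
    (inner_toEuclideanCLM_le A y).trans (by gcongr)
  rw [map_sub, map_smul, ← hy, inner_sub_left, inner_sub_right, inner_sub_right,
    real_inner_smul_left, real_inner_smul_right, real_inner_smul_left, real_inner_smul_right,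
    real_inner_self_eq_norm_sq, inner_toEuclideanCLM_comm hA.1 x y, ← hy,
    real_inner_self_eq_norm_sq] at h
  have h3 : 0 ≤ c * (c * inner ℝ x y - ‖y‖ ^ 2) := by linarith
  linarith [nonneg_of_mul_nonneg_right h3 hc]

theorem volume_iUnion_ball_eq_top {u : Vec p} (hu : ‖u‖ = 2) :
    (volume : Measure (Vec p)) (⋃ n : ℕ, Metric.ball ((n : ℝ) • u) 1) = ⊤ := by
  rw [measure_iUnion _ fun n => measurableSet_ball]
  · simp_rw [Measure.addHaar_ball_center]
    exact ENNReal.tsum_const_eq_top_of_ne_zero (Metric.measure_ball_pos volume 0 one_pos).ne'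
  · intro m n hmn
    refine Metric.ball_disjoint_ball ?_
    rw [dist_eq_norm, ← sub_smul, norm_smul, hu, Real.norm_eq_abs]
    have : (1 : ℝ) ≤ |(m : ℝ) - n| := by
      have h : (1 : ℤ) ≤ |(m : ℤ) - n| := Int.one_le_abs (sub_ne_zero.2 (by exact_mod_cast hmn))
      exact_mod_cast h
    linarith

namespace Params
variable {Q : Params p}

/-- Along a common null direction of `M` and `H` the posterior kernel does not decay. -/
theorem exists_le_posteriorKernel_add_smul (hM : Q.M.PosSemidef) (hκ : ∀ j, 0 ≤ Q.κ j)
    {v : Vec p} (hMv : Matrix.toEuclideanCLM (𝕜 := ℝ) Q.M v = 0)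
    (hHs : Q.H.IsHermitian) (hHv : Matrix.toEuclideanCLM (𝕜 := ℝ) Q.H v = 0)
    (hv : 0 ≤ inner ℝ (Q.φ + Q.ψ) v) :
    ∃ ε : ℝ, 0 < ε ∧ ∀ (w : Vec p) (s : ℝ), ‖w‖ ≤ 1 → 0 ≤ s →
      ε ≤ Q.posteriorKernel (w + s • v) := by
  set k := ‖Q.κ‖ with hk
  refine ⟨Real.exp (-(spectralNorm Q.M * (1 + k) ^ 2 / 2 + ‖Q.φ‖ * (1 + k) +
    spectralNorm Q.H / 2 + ‖Q.ψ‖)), Real.exp_pos _, fun w s hw hs => ?_⟩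
  -- Thresholding moves points boundedly, so `θ` is `s • v` plus a bounded vector; the quadratic
  -- forms ignore `s • v`, and the linear terms only gain from it.
  set z := w + (Q.theta (w + s • v) - (w + s • v)) with hz
  have hθ : Q.theta (w + s • v) = z + s • v := by rw [hz]; abel
  have hzn : ‖z‖ ≤ 1 + k :=
    (norm_add_le _ _).trans (add_le_add hw (norm_theta_sub_le hκ _))
  have hquad : ∀ {A : Matrix (Fin p) (Fin p) ℝ}, A.IsHermitian →
      Matrix.toEuclideanCLM (𝕜 := ℝ) A v = 0 → ∀ y : Vec p,
      inner ℝ (y + s • v) (Matrix.toEuclideanCLM (𝕜 := ℝ) A (y + s • v)) =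
        inner ℝ y (Matrix.toEuclideanCLM (𝕜 := ℝ) A y) := by
    intro A hA hAv y
    rw [map_add, map_smul, hAv, smul_zero, add_zero, inner_add_left, real_inner_smul_left,
      inner_toEuclideanCLM_comm hA v y, hAv, inner_zero_left, mul_zero, add_zero]
  rw [posteriorKernel, hθ, hquad hM.1 hMv, hquad hHs hHv, ← Real.exp_add]
  refine Real.exp_le_exp.2 ?_
  have h1 : inner ℝ z (Matrix.toEuclideanCLM (𝕜 := ℝ) Q.M z) ≤
      spectralNorm Q.M * (1 + k) ^ 2 := by
    refine (inner_toEuclideanCLM_le _ _).trans ?_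
    have := spectralNorm_nonneg Q.M
    gcongr
  have h2 : inner ℝ w (Matrix.toEuclideanCLM (𝕜 := ℝ) Q.H w) ≤ spectralNorm Q.H := by
    refine (inner_toEuclideanCLM_le _ _).trans ?_
    have := spectralNorm_nonneg Q.H
    calc _ ≤ spectralNorm Q.H * 1 ^ 2 := by gcongr
      _ = _ := by ring
  have h3 : -(‖Q.φ‖ * (1 + k)) ≤ inner ℝ Q.φ z := by
    have := (abs_le.1 (abs_real_inner_le_norm Q.φ z)).1
    have : ‖Q.φ‖ * ‖z‖ ≤ ‖Q.φ‖ * (1 + k) := by gcongr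
    linarith
  have h4 : -‖Q.ψ‖ ≤ inner ℝ Q.ψ w := by
    have := (abs_le.1 (abs_real_inner_le_norm Q.ψ w)).1
    have : ‖Q.ψ‖ * ‖w‖ ≤ ‖Q.ψ‖ * 1 := by gcongr
    linarith
  have h5 := mul_nonneg hs hv
  rw [inner_add_left] at h5
  rw [inner_add_right Q.φ z, inner_add_right Q.ψ w, real_inner_smul_right, real_inner_smul_right]
  linarith

/-- A null vector of `M + H` is one of both summands. With the sign making its product with `φ + ψ`
nonnegative, it carries infinitely many disjoint unit balls on which the kernel exceeds a fixed `ε`,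
contradicting integrability. -/
theorem inner_add_pos_of_integrable (hM : Q.M.PosSemidef) (hH : Q.H.PosSemidef)
    (hκ : ∀ j, 0 ≤ Q.κ j) (hQ : Integrable Q.posteriorKernel) {v : Vec p} (hv : v ≠ 0) :
    0 < inner ℝ v (Matrix.toEuclideanCLM (𝕜 := ℝ) (Q.M + Q.H) v) := by
  have hsplit : ∀ v, inner ℝ v (Matrix.toEuclideanCLM (𝕜 := ℝ) (Q.M + Q.H) v) =
      inner ℝ v (Matrix.toEuclideanCLM (𝕜 := ℝ) Q.M v) +
      inner ℝ v (Matrix.toEuclideanCLM (𝕜 := ℝ) Q.H v) := fun v => by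
    rw [map_add, add_apply, inner_add_right]
  have key : ∀ u : Vec p, ‖u‖ = 2 → 0 ≤ inner ℝ (Q.φ + Q.ψ) u →
      inner ℝ u (Matrix.toEuclideanCLM (𝕜 := ℝ) (Q.M + Q.H) u) ≠ 0 := by
    intro u hu hpos h0
    rw [hsplit] at h0
    have hM0 := inner_toEuclideanCLM_nonneg hM u
    have hH0 := inner_toEuclideanCLM_nonneg hH u
    have hnull : ∀ {A : Matrix (Fin p) (Fin p) ℝ}, A.PosSemidef →
        inner ℝ u (Matrix.toEuclideanCLM (𝕜 := ℝ) A u) = 0 →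
        Matrix.toEuclideanCLM (𝕜 := ℝ) A u = 0 := by
      intro A hA h
      have := sq_norm_toEuclideanCLM_le hA (c := spectralNorm A + 1)
        (by linarith [spectralNorm_nonneg A]) (by linarith) u
      rw [h, mul_zero] at this
      exact norm_eq_zero.1 (pow_eq_zero_iff two_ne_zero |>.1 (le_antisymm this (by positivity)))
    obtain ⟨ε, hε, hlow⟩ := exists_le_posteriorKernel_add_smul hM hκ
      (hnull hM (by linarith)) hH.1 (hnull hH (by linarith)) hpos
    have hfin := hQ.measure_ge_lt_top hε
    refine (hfin.trans_le' (measure_mono ?_)).ne (volume_iUnion_ball_eq_top hu)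
    refine Set.iUnion_subset fun n β hβ => ?_
    have hβ' : ‖β - (n : ℝ) • u‖ ≤ 1 := (mem_ball_iff_norm.1 hβ).le
    have := hlow (β - (n : ℝ) • u) n hβ' n.cast_nonneg
    rwa [sub_add_cancel] at this
  have hvn : 0 < ‖v‖ := norm_pos_iff.2 hv
  have hnn : 0 ≤ inner ℝ v (Matrix.toEuclideanCLM (𝕜 := ℝ) (Q.M + Q.H) v) :=
    inner_toEuclideanCLM_nonneg (hM.add hH) v
  refine lt_of_le_of_ne hnn fun h => ?_
  have hs : ∀ s : ℝ, inner ℝ (s • v)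
      (Matrix.toEuclideanCLM (𝕜 := ℝ) (Q.M + Q.H) (s • v)) = 0 := fun s => by
    rw [map_smul, real_inner_smul_left, real_inner_smul_right, ← h, mul_zero, mul_zero]
  rcases le_total 0 (inner ℝ (Q.φ + Q.ψ) v) with h1 | h1
  · refine key ((2 / ‖v‖) • v) ?_ ?_ (hs _)
    · rw [norm_smul, Real.norm_of_nonneg (by positivity)]
      field_simp
    · rw [real_inner_smul_right]
      positivity
  · refine key ((-(2 / ‖v‖)) • v) ?_ ?_ (hs _)
    · rw [norm_smul, norm_neg, Real.norm_of_nonneg (by positivity)]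
      field_simp
    · rw [real_inner_smul_right]
      have : 0 ≤ 2 / ‖v‖ := by positivity
      nlinarith

/-- With `A = M + H`, the bound `A² ≤ cA` gives `‖c x - A x‖² ≤ c²‖x‖² - c⟨x, A x⟩ < c²‖x‖²` for `x
≠ 0`; compactness of the sphere makes the gap uniform. The sphere is empty when `p = 0`. -/
theorem exists_norm_smul_sub_le (hM : Q.M.PosSemidef) (hH : Q.H.PosSemidef)
    (hκ : ∀ j, 0 ≤ Q.κ j) (hd : spectralNorm Q.M < Q.d) (he : spectralNorm Q.H < Q.e)
    (hQ : Integrable Q.posteriorKernel) :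
    ∃ ρ : ℝ, 0 ≤ ρ ∧ ρ < Q.d + Q.e ∧ ∀ x : Vec p,
      ‖(Q.d + Q.e) • x - Matrix.toEuclideanCLM (𝕜 := ℝ) (Q.M + Q.H) x‖ ≤ ρ * ‖x‖ := by
  set c := Q.d + Q.e with hc
  have hc0 : 0 < c := add_pos ((spectralNorm_nonneg _).trans_lt hd)
    ((spectralNorm_nonneg _).trans_lt he)
  set A := Matrix.toEuclideanCLM (𝕜 := ℝ) (Q.M + Q.H) with hA
  have hAc : spectralNorm (Q.M + Q.H) ≤ c := by
    rw [spectralNorm, map_add]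
    exact (norm_add_le _ _).trans (add_le_add hd.le he.le)
  have hstrict : ∀ x : Vec p, x ≠ 0 → ‖c • x - A x‖ < c * ‖x‖ := by
    intro x hx
    have h1 := inner_add_pos_of_integrable hM hH hκ hQ hx
    have h2 := sq_norm_toEuclideanCLM_le (hM.add hH) hc0 hAc x
    rw [← hA] at h1 h2
    refine lt_of_pow_lt_pow_left₀ 2 (by positivity) ?_
    rw [norm_sub_sq_real, norm_smul, Real.norm_of_nonneg hc0.le, real_inner_smul_left]
    have := mul_pos hc0 h1
    linarith
  rcases (Metric.sphere (0 : Vec p) 1).eq_empty_or_nonempty with hS | hS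
  · refine ⟨0, le_rfl, hc0, fun x => ?_⟩
    have hx : x = 0 := by
      by_contra hx
      have : ‖x‖⁻¹ • x ∈ Metric.sphere (0 : Vec p) 1 := by
        rw [mem_sphere_zero_iff_norm, norm_smul, norm_inv, norm_norm,
          inv_mul_cancel₀ (norm_ne_zero_iff.2 hx)]
      rw [hS] at this
      exact this
    simp [hx]
  · obtain ⟨x₀, hx₀, hmax⟩ := (isCompact_sphere (0 : Vec p) 1).exists_isMaxOn hS
      (f := fun x => ‖c • x - A x‖) (by fun_prop)
    have hx₀n : ‖x₀‖ = 1 := mem_sphere_zero_iff_norm.1 hx₀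
    refine ⟨‖c • x₀ - A x₀‖, norm_nonneg _, ?_, fun x => ?_⟩
    · have := hstrict x₀ (norm_ne_zero_iff.1 (by rw [hx₀n]; norm_num))
      rwa [hx₀n, mul_one] at this
    · rcases eq_or_ne x 0 with rfl | hx
      · simp
      · have hxn : 0 < ‖x‖ := norm_pos_iff.2 hx
        have hmem : ‖x‖⁻¹ • x ∈ Metric.sphere (0 : Vec p) 1 := by
          rw [mem_sphere_zero_iff_norm, norm_smul, norm_inv, norm_norm,
            inv_mul_cancel₀ hxn.ne']
        have h : ‖c • (‖x‖⁻¹ • x) - A (‖x‖⁻¹ • x)‖ ≤ ‖c • x₀ - A x₀‖ := hmax hmem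
        rw [map_smul, smul_comm, ← smul_sub, norm_smul, norm_inv, norm_norm,
          inv_mul_le_iff₀ hxn] at h
        linarith

end Params

/-! ### Drift and minorization for the marginal chain -/

namespace Params
variable {Q : Params p}

/-- Lyapunov function of the marginal chain. -/
def lyapunov (ε : ℝ) (x : Vec p × Vec p) : ℝ := ‖x.1 + x.2‖ + ε * (‖x.1‖ + ‖x.2‖)

theorem continuous_lyapunov (ε : ℝ) : Continuous (lyapunov ε : Vec p × Vec p → ℝ) := by
  unfold lyapunov; fun_prop

theorem lyapunov_nonneg {ε : ℝ} (hε : 0 ≤ ε) (x : Vec p × Vec p) : 0 ≤ lyapunov ε x := by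
  unfold lyapunov; positivity

theorem exists_integral_lyapunov_rtKernel_le (Q : Params p) {ε : ℝ} (hε : 0 ≤ ε) :
    ∃ C : ℝ, 0 ≤ C ∧ ∀ β : Vec p, Integrable (lyapunov ε) (Q.rtKernel β) ∧
      ∫ x, lyapunov ε x ∂Q.rtKernel β ≤ lyapunov ε
        (Q.d • Q.theta β - Matrix.toEuclideanCLM (𝕜 := ℝ) Q.M (Q.theta β),
          Q.e • β - Matrix.toEuclideanCLM (𝕜 := ℝ) Q.H β) + C := by
  obtain ⟨C₁, hC₁, h₁⟩ := exists_integral_norm_sub_multivariateGaussian_eq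
    (Q.d • (1 : Matrix (Fin p) (Fin p) ℝ) - Q.M)
  obtain ⟨C₂, hC₂, h₂⟩ := exists_integral_norm_sub_multivariateGaussian_eq
    (Q.e • (1 : Matrix (Fin p) (Fin p) ℝ) - Q.H)
  refine ⟨(1 + ε) * (C₁ + C₂), by positivity, fun β => ?_⟩
  rw [rtKernel_apply, toEuclideanCLM_smul_one_sub, toEuclideanCLM_smul_one_sub]
  set m₁ := Q.d • Q.theta β - Matrix.toEuclideanCLM (𝕜 := ℝ) Q.M (Q.theta β)
  set m₂ := Q.e • β - Matrix.toEuclideanCLM (𝕜 := ℝ) Q.H β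
  obtain ⟨i₁, e₁⟩ := h₁ m₁
  obtain ⟨i₂, e₂⟩ := h₂ m₂
  set ν₁ := multivariateGaussian m₁ (Q.d • (1 : Matrix (Fin p) (Fin p) ℝ) - Q.M)
  set ν₂ := multivariateGaussian m₂ (Q.e • (1 : Matrix (Fin p) (Fin p) ℝ) - Q.H)
  have j₁ : Integrable (fun x : Vec p × Vec p => ‖x.1 - m₁‖) (ν₁.prod ν₂) := i₁.comp_fst ν₂
  have j₂ : Integrable (fun x : Vec p × Vec p => ‖x.2 - m₂‖) (ν₁.prod ν₂) := i₂.comp_snd ν₁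
  have hpt : ∀ x : Vec p × Vec p, lyapunov ε x ≤
      lyapunov ε (m₁, m₂) + (1 + ε) * (‖x.1 - m₁‖ + ‖x.2 - m₂‖) := by
    rintro ⟨r, t⟩
    simp only [lyapunov]
    have a1 : ‖r‖ ≤ ‖m₁‖ + ‖r - m₁‖ := by simpa using norm_add_le m₁ (r - m₁)
    have a2 : ‖t‖ ≤ ‖m₂‖ + ‖t - m₂‖ := by simpa using norm_add_le m₂ (t - m₂)
    have a3 : ‖r + t‖ ≤ ‖m₁ + m₂‖ + (‖r - m₁‖ + ‖t - m₂‖) := by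
      have : r + t = (m₁ + m₂) + ((r - m₁) + (t - m₂)) := by abel
      rw [this]
      exact (norm_add_le _ _).trans (by gcongr; exact norm_add_le _ _)
    have a4 : ε * (‖r‖ + ‖t‖) ≤ ε * (‖m₁‖ + ‖r - m₁‖ + (‖m₂‖ + ‖t - m₂‖)) := by gcongr
    linarith
  have j₃ : Integrable (fun x : Vec p × Vec p => (1 + ε) * (‖x.1 - m₁‖ + ‖x.2 - m₂‖))
      (ν₁.prod ν₂) := (j₁.add j₂).const_mul _
  have j₄ : Integrable (fun x : Vec p × Vec p =>
      lyapunov ε (m₁, m₂) + (1 + ε) * (‖x.1 - m₁‖ + ‖x.2 - m₂‖)) (ν₁.prod ν₂) :=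
    (integrable_const _).add j₃
  have hi : Integrable (lyapunov ε) (ν₁.prod ν₂) := by
    refine j₄.mono' (continuous_lyapunov ε).aestronglyMeasurable
      (Filter.Eventually.of_forall fun x => ?_)
    rw [Real.norm_of_nonneg (lyapunov_nonneg hε x)]
    exact hpt x
  refine ⟨hi, (integral_mono hi j₄ hpt).trans_eq ?_⟩
  rw [integral_add (integrable_const _) j₃, integral_const_mul, integral_add j₁ j₂,
    integral_fun_fst (fun r => ‖r - m₁‖), integral_fun_snd (fun t => ‖t - m₂‖), e₁, e₂]
  simp

/-- Geometric drift of the marginal chain. -/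
theorem exists_drift (hM : Q.M.PosSemidef) (hH : Q.H.PosSemidef) (hκ : ∀ j, 0 ≤ Q.κ j)
    (hd : spectralNorm Q.M < Q.d) (he : spectralNorm Q.H < Q.e)
    (hQ : Integrable Q.posteriorKernel) :
    ∃ ε g K : ℝ, 0 < ε ∧ g < 1 ∧ 0 ≤ K ∧ ∀ x : Vec p × Vec p,
      Integrable (lyapunov ε) (Q.step x) ∧
      ∫ u, lyapunov ε u ∂Q.step x ≤ g * lyapunov ε x + K := by
  have hd0 : 0 < Q.d := (spectralNorm_nonneg _).trans_lt hd
  have he0 : 0 < Q.e := (spectralNorm_nonneg _).trans_lt he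
  have hmk := isMarkovKernel_betaKernel hd0 he0 hκ
  obtain ⟨ρ, hρ0, hρc, hρ⟩ := exists_norm_smul_sub_le hM hH hκ hd he hQ
  obtain ⟨C, hC0, hC⟩ := exists_integral_sq_norm_sub_center_le hd0 he0 hκ
  set c := Q.d + Q.e with hc
  have hc0 : 0 < c := by positivity
  set k := ‖Q.κ‖
  have hk0 : 0 ≤ k := norm_nonneg _
  set A₁ : Vec p →L[ℝ] Vec p :=
    Q.d • ContinuousLinearMap.id ℝ (Vec p) - Matrix.toEuclideanCLM (𝕜 := ℝ) Q.M with hA₁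
  set A₂ : Vec p →L[ℝ] Vec p :=
    Q.e • ContinuousLinearMap.id ℝ (Vec p) - Matrix.toEuclideanCLM (𝕜 := ℝ) Q.H with hA₂
  set a := ‖A₁‖ + ‖A₂‖ with ha
  have ha0 : 0 ≤ a := by positivity
  -- The `ε`-term of the Lyapunov function grows by at most `ε * a` times `‖β‖`, up to constants;
  -- this must fit into the gap `c - ρ`.
  obtain ⟨ε, hε, hεa⟩ : ∃ ε : ℝ, 0 < ε ∧ ρ + ε * a < c := by
    refine ⟨(c - ρ) / (2 * (a + 1)), div_pos (by linarith) (by positivity), ?_⟩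
    have : (c - ρ) / (2 * (a + 1)) * a ≤ (c - ρ) / 2 := by
      rw [div_mul_eq_mul_div, div_le_div_iff₀ (by positivity) (by positivity)]
      nlinarith
    linarith
  obtain ⟨C₀, hC₀, hrt⟩ := Q.exists_integral_lyapunov_rtKernel_le hε.le
  set B := ρ + ε * a with hB
  have hB0 : 0 ≤ B := by positivity
  set K₁ := (1 + ε) * a * k + C₀ with hK₁
  have hK₁0 : 0 ≤ K₁ := by positivity
  -- Weight in `u ≤ δu² + 1/(4δ)` for `u = ‖β - center‖`, chosen so that the second moment bound
  -- costs at most `(ε/2)(1 + ‖r‖ + ‖t‖)`.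
  set δ := ε / (2 * (B * C + 1)) with hδ
  have hδ0 : 0 < δ := by positivity
  have hδB : B * δ * C ≤ ε / 2 := by
    rw [hδ]
    have : B * (ε / (2 * (B * C + 1))) * C = ε * (B * C) / (2 * (B * C + 1)) := by ring
    have hBC : 0 ≤ B * C := by positivity
    rw [this, div_le_div_iff₀ (by positivity) (by positivity)]
    nlinarith
  have hmean : ∀ r t β : Vec p, ∫ x, lyapunov ε x ∂Q.rtKernel β ≤
      B / c * ‖r + t‖ + B * δ * ‖β - Q.center r t‖ ^ 2 + (B / (4 * δ) + K₁) := by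
    intro r t β
    refine (hrt β).2.trans ?_
    set μ := Q.center r t with hμ
    have hμn : ‖μ‖ = ‖r + t‖ / c := by
      rw [hμ, center, norm_smul, norm_inv, Real.norm_of_nonneg hc0.le, ← div_eq_inv_mul]
    have hδβ : ‖Q.theta β - β‖ ≤ k := norm_theta_sub_le hκ β
    have hβ : ‖β‖ ≤ ‖μ‖ + ‖β - μ‖ := by simpa using norm_add_le μ (β - μ)
    have e1 : Q.d • Q.theta β - Matrix.toEuclideanCLM (𝕜 := ℝ) Q.M (Q.theta β) =
        A₁ (Q.theta β) := rfl
    have e2 : Q.e • β - Matrix.toEuclideanCLM (𝕜 := ℝ) Q.H β = A₂ β := rfl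
    have e3 : A₁ β + A₂ β = c • β - Matrix.toEuclideanCLM (𝕜 := ℝ) (Q.M + Q.H) β := by
      simp only [hA₁, hA₂, sub_apply, smul_apply,
        ContinuousLinearMap.id_apply, map_add, add_apply, hc, add_smul]
      abel
    have e4 : A₁ (Q.theta β) + A₂ β = (A₁ β + A₂ β) + A₁ (Q.theta β - β) := by
      rw [map_sub]; abel
    have b1 : ‖A₁ (Q.theta β - β)‖ ≤ a * k :=
      (A₁.le_opNorm _).trans (mul_le_mul (by rw [ha]; linarith [norm_nonneg A₂]) hδβ
        (norm_nonneg _) ha0)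
    have b2 : ‖A₁ (Q.theta β) + A₂ β‖ ≤ ρ * (‖μ‖ + ‖β - μ‖) + a * k := by
      rw [e4, e3]
      refine (norm_add_le _ _).trans (add_le_add ((hρ β).trans ?_) b1)
      gcongr
    have b3 : ‖A₁ (Q.theta β)‖ ≤ ‖A₁‖ * ‖β‖ + a * k := by
      have : A₁ (Q.theta β) = A₁ β + A₁ (Q.theta β - β) := by rw [map_sub]; abel
      rw [this]
      exact (norm_add_le _ _).trans (add_le_add (A₁.le_opNorm _) b1)
    have b4 : ‖A₁ (Q.theta β)‖ + ‖A₂ β‖ ≤ a * (‖μ‖ + ‖β - μ‖) + a * k := by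
      have h1 := A₂.le_opNorm β
      have h2 : a * ‖β‖ ≤ a * (‖μ‖ + ‖β - μ‖) := by gcongr
      have h3 : a * ‖β‖ = ‖A₁‖ * ‖β‖ + ‖A₂‖ * ‖β‖ := by rw [ha]; ring
      linarith
    have b5 : ε * (‖A₁ (Q.theta β)‖ + ‖A₂ β‖) ≤ ε * (a * (‖μ‖ + ‖β - μ‖) + a * k) := by gcongr
    have b6 : ‖β - μ‖ ≤ δ * ‖β - μ‖ ^ 2 + 1 / (4 * δ) := by
      have h : δ * ‖β - μ‖ ^ 2 + 1 / (4 * δ) - ‖β - μ‖ = (2 * δ * ‖β - μ‖ - 1) ^ 2 / (4 * δ) := by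
        field_simp
        ring
      have : 0 ≤ (2 * δ * ‖β - μ‖ - 1) ^ 2 / (4 * δ) := by positivity
      linarith
    rw [e1, e2]
    simp only [lyapunov]
    calc _ ≤ B * ‖μ‖ + B * ‖β - μ‖ + K₁ := by rw [hB, hK₁]; linarith
      _ ≤ B * ‖μ‖ + B * (δ * ‖β - μ‖ ^ 2 + 1 / (4 * δ)) + K₁ := by gcongr
      _ = _ := by rw [hμn]; ring
  -- The first entry is the contraction of `‖r + t‖`, the second the half of `ε(‖r‖ + ‖t‖)` spent on
  -- the fluctuations of `β`.
  set g := max (B / c) (1 / 2) with hg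
  refine ⟨ε, g, ε / 2 + (B / (4 * δ) + K₁), hε, ?_, by positivity, ?_⟩
  · exact max_lt (by rw [div_lt_one hc0]; exact hεa) (by norm_num)
  rintro ⟨r, t⟩
  obtain ⟨hi, hle⟩ := hC r t
  have hbi : Integrable (fun β => B * δ * ‖β - Q.center r t‖ ^ 2) (Q.betaKernel (r, t)) :=
    hi.const_mul _
  have hbi2 : Integrable (fun β => B / c * ‖r + t‖ + B * δ * ‖β - Q.center r t‖ ^ 2)
      (Q.betaKernel (r, t)) := (integrable_const _).add hbi
  have hbi3 : Integrable (fun β => B / c * ‖r + t‖ + B * δ * ‖β - Q.center r t‖ ^ 2 +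
      (B / (4 * δ) + K₁)) (Q.betaKernel (r, t)) := hbi2.add (integrable_const _)
  have hsm : StronglyMeasurable (lyapunov ε : Vec p × Vec p → ℝ) :=
    (continuous_lyapunov ε).stronglyMeasurable
  have hnonneg : ∀ β, 0 ≤ ∫ x, lyapunov ε x ∂Q.rtKernel β := fun β =>
    integral_nonneg fun x => lyapunov_nonneg hε.le x
  have hinner : Integrable (fun β => ∫ x, lyapunov ε x ∂Q.rtKernel β) (Q.betaKernel (r, t)) := by
    refine hbi3.mono' hsm.integral_kernel.aestronglyMeasurable
      (Filter.Eventually.of_forall fun β => ?_)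
    rw [Real.norm_of_nonneg (hnonneg β)]
    exact hmean r t β
  have hstep : Integrable (lyapunov ε) (Q.step (r, t)) := by
    rw [step, integrable_comp_iff hsm.aestronglyMeasurable]
    refine ⟨Filter.Eventually.of_forall fun β => (hrt β).1, ?_⟩
    simpa only [Real.norm_of_nonneg (lyapunov_nonneg hε.le _)] using hinner
  refine ⟨hstep, ?_⟩
  rw [step, Kernel.integral_comp hstep]
  refine (integral_mono hinner hbi3 (hmean r t)).trans ?_
  rw [integral_add hbi2 (integrable_const _), integral_add (integrable_const _) hbi,
    integral_const_mul (B * δ), integral_const, integral_const, probReal_univ, one_smul, one_smul]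
  have h1 : B * δ * ∫ β, ‖β - Q.center r t‖ ^ 2 ∂Q.betaKernel (r, t) ≤
      ε / 2 * (1 + ‖r‖ + ‖t‖) := by
    calc _ ≤ B * δ * (C * (1 + ‖r‖ + ‖t‖)) := by gcongr
      _ = B * δ * C * (1 + ‖r‖ + ‖t‖) := by ring
      _ ≤ _ := by gcongr
  have h2 : B / c * ‖r + t‖ ≤ g * ‖r + t‖ := by gcongr; exact le_max_left _ _
  have h3 : 1 / 2 * (ε * (‖r‖ + ‖t‖)) ≤ g * (ε * (‖r‖ + ‖t‖)) := by
    gcongr; exact le_max_right _ _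
  simp only [lyapunov]
  linarith

/-- Since `ε > 0`, a sublevel set bounds `‖r‖ + ‖t‖`; the lower bound for the draw of `β` is then
pushed through `rtKernel`. -/
theorem exists_minorization (hκ : ∀ j, 0 ≤ Q.κ j) (hd : 0 < Q.d) (he : 0 < Q.e) {ε : ℝ}
    (hε : 0 < ε) (R : ℝ) :
    ∃ ρ : Measure (Vec p × Vec p), ρ ≠ 0 ∧ ∀ x, lyapunov ε x ≤ R → ρ ≤ Q.step x := by
  obtain ⟨ρ, hρ0, hρ⟩ := exists_le_betaKernel hd he hκ (R / ε)
  refine ⟨Q.rtKernel ∘ₘ ρ, ?_, ?_⟩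
  · intro h
    have h1 : (Q.rtKernel ∘ₘ ρ) Set.univ = 0 := by rw [h]; simp
    rw [Measure.bind_apply MeasurableSet.univ (Kernel.aemeasurable _)] at h1
    simp only [measure_univ, lintegral_const, one_mul] at h1
    exact hρ0 (Measure.measure_univ_eq_zero.1 h1)
  · rintro ⟨r, t⟩ hx
    have hrt : ‖r‖ + ‖t‖ ≤ R / ε := by
      rw [le_div_iff₀ hε]
      simp only [lyapunov] at hx
      linarith [norm_nonneg (r + t)]
    rw [step, Kernel.comp_apply]
    refine Measure.le_iff.2 fun s hs => ?_
    rw [Measure.bind_apply hs (Kernel.aemeasurable _),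
      Measure.bind_apply hs (Kernel.aemeasurable _)]
    exact lintegral_mono' (hρ r t hrt) le_rfl

end Params
end AntiCorrelation
end

/-! ### Geometric ergodicity of the marginal chain -/

theorem theorem2 {p : ℕ} (Q : AntiCorrelation.Params p)
    (hM : Q.M.PosSemidef) (hH : Q.H.PosSemidef) (hκ : ∀ j, 0 ≤ Q.κ j)
    (hd : AntiCorrelation.spectralNorm Q.M < Q.d)
    (he : AntiCorrelation.spectralNorm Q.H < Q.e)
    (hproper : MeasureTheory.Integrable Q.posteriorKernel MeasureTheory.volume) :
    ∃ (C₁ : AntiCorrelation.Vec p × AntiCorrelation.Vec p → ℝ) (γ : ℝ), 0 < γ ∧ γ < 1 ∧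
      ∀ (x : AntiCorrelation.Vec p × AntiCorrelation.Vec p) (m : ℕ),
        AntiCorrelation.tvDist (Q.stepIter m x) Q.target ≤ C₁ x * γ ^ m := by
  have hd0 : 0 < Q.d := (AntiCorrelation.spectralNorm_nonneg _).trans_lt hd
  have he0 : 0 < Q.e := (AntiCorrelation.spectralNorm_nonneg _).trans_lt he
  have hmk := AntiCorrelation.Params.isMarkovKernel_betaKernel hd0 he0 hκ
  have hstep : IsMarkovKernel Q.step := by
    unfold AntiCorrelation.Params.step; infer_instance
  have hpost := AntiCorrelation.Params.isProbabilityMeasure_posterior hproper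
  have htarget : IsProbabilityMeasure Q.target := by
    unfold AntiCorrelation.Params.target; infer_instance
  obtain ⟨ε, g, K, hε, hg, hK, hdrift⟩ :=
    AntiCorrelation.Params.exists_drift hM hH hκ hd he hproper
  exact AntiCorrelation.exists_tvDist_le_geometric
    (AntiCorrelation.Params.continuous_lyapunov ε).measurable
    (AntiCorrelation.Params.lyapunov_nonneg hε.le) hg hK (fun x => (hdrift x).1)
    (fun x => (hdrift x).2) (AntiCorrelation.Params.exists_minorization hκ hd0 he0 hε)
    (AntiCorrelation.Params.step_comp_target hM hH hκ hd he) Q.stepIter rfl fun _ => rfl
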